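/- Let $k$ be a field, let $\mathbb G$ be $\mathbb Z$ or $\mathbb Z/2$ (more generally, any abelian group with a distinguished element $1$ and a parity homomorphism $\mathbb G\to\mathbb Z/2$, $1\mapsto 1$), and let $\mathcal A$ be a differential $\mathbb G$-graded $k$-category. Let $P,N$ be objects of $\mathcal A$ such that $P$ is a direct summand of $N$: there are closed morphisms $i:P\to N$ and $j:N\to P$ of degree $0$ with $j\circ i=1_P$. Put $\pi:=i\circ j\in\operatorname{End}(N)$, and let $\{P,N\}$ be the full dg subcategory of $\mathcal A$ on the objects $P$ and $N$. Let $(\overline C\{P,N\},b,B)$ be the normalized mixed Hochschild complex of $\{P,N\}$. It is spanned by the words $a_0[a_1|\cdots|a_n]$, $n\ge 0$, of homogeneous cyclically composable morphisms, $k$-linear in each letter, of degree $|a_0|+\sum_{l\ge1}(|a_l|-1)$, and words with $a_l$ an identity for some $l\ge 1$ are zero. Here $$\begin{aligned} b(a_0[a_1|\cdots|a_n])={}&(da_0)[a_1|\cdots|a_n]+\sum_{l=1}^{n}(-1)^{|a_0|+\cdots+|a_{l-1}|-l}\,a_0[a_1|\cdots|da_l|\cdots|a_n]\\ &+(-1)^{|a_0|}a_0a_1[a_2|\cdots|a_n]+\sum_{l=1}^{n-1}(-1)^{|a_0|+\cdots+|a_l|-l}\,a_0[a_1|\cdots|a_la_{l+1}|\cdots|a_n]\\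 &-(-1)^{(|a_n|-1)(|a_0|+\cdots+|a_{n-1}|-(n-1))}\,a_na_0[a_1|\cdots|a_{n-1}]\end{aligned}$$ (the terms that involve $a_1$ or $a_n$ outside their range, for $n=0$, are absent), and $B$ is Connes' operator, which sends $a_0[a_1|\cdots|a_n]$ to the sum of the words $1[a_l|\cdots|a_n|a_0|\cdots|a_{l-1}]$ over the $n+1$ cyclic rotations, $1$ being the identity of the codomain of the letter that follows it, with sign $(-1)^{(|a_0|+\cdots+|a_{l-1}|-l)(|a_l|+\cdots+|a_n|-(n-l+1))}$. Let $u$ be a variable of degree $2$; $(\overline C\{P,N\}[[u]],\,b+uB)$ is the normalized negative cyclic complex. Then $1_P$ and $$\eta_\pi:=\pi+\sum_{i\ge1}(-1)^i\,\frac{(2i)!}{2\,(i!)}\,(2\pi-1_N)[\underbrace{\pi|\cdots|\pi}_{2i}]\,u^i$$ (the coefficients $(2i)!/(2\,(i!))$ are integers) are cycles of degree $0$ in $(\overline C\{P,N\}[[u]],\,b+uB)$, and they are homologous there: there is an element $w$ of degree $-1$ with $(b+uB)(w)=1_P-\eta_\pi$. -/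

import Mathlib

universe u v w w'

/-- A grading group: an abelian group `G` with a distinguished element `1` (the degree of a
differential) and a parity `G → ℤ/2` with `1 ↦ 1`. The two standard cases `G = ℤ` and
`G = ℤ/2` are given by the instances below. -/
class GradingParity (G : Type w) [AddCommGroupWithOne G] where
  parity : G →+ ZMod 2
  parity_one : parity 1 = 1

instance : GradingParity ℤ where
  parity := (Int.castRingHom (ZMod 2)).toAddMonoidHom
  parity_one := by simp

instance : GradingParity (ZMod 2) where
  parity := AddMonoidHom.id _
  parity_one := rfl

/-- A (small) differential `G`-graded category over `k`. The morphisms `x → y` are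
`Hom x y = ⨁ g, grade x y g`, and `comp f g` is `f ∘ g`. -/
structure DGCategory (k : Type w') [CommRing k] (G : Type w) [AddCommGroupWithOne G]
    [GradingParity G] where
  Obj : Type u
  Hom : Obj → Obj → Type v
  [addCommGroup : ∀ x y, AddCommGroup (Hom x y)]
  [module : ∀ x y, Module k (Hom x y)]
  grade : ∀ x y, G → Submodule k (Hom x y)
  grade_isInternal : ∀ x y, letI := Classical.decEq G; DirectSum.IsInternal (grade x y)
  d : ∀ x y, Hom x y →ₗ[k] Hom x y
  comp : ∀ {x y z}, Hom y z →ₗ[k] Hom x y →ₗ[k] Hom x z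
  one : ∀ x, Hom x x
  comp_assoc : ∀ {w x y z} (f : Hom y z) (g : Hom x y) (h : Hom w x),
    comp (comp f g) h = comp f (comp g h)
  one_comp : ∀ {x y} (f : Hom x y), comp (one y) f = f
  comp_one : ∀ {x y} (f : Hom x y), comp f (one x) = f
  one_mem : ∀ x, one x ∈ grade x x 0
  comp_mem : ∀ {x y z g h} {f : Hom y z} {f' : Hom x y},
    f ∈ grade y z g → f' ∈ grade x y h → comp f f' ∈ grade x z (g + h)
  d_mem : ∀ {x y g} {f : Hom x y}, f ∈ grade x y g → d x y f ∈ grade x y (g + 1)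
  d_d : ∀ {x y} (f : Hom x y), d x y (d x y f) = 0
  d_comp : ∀ {x y z g} {f : Hom y z} (_ : f ∈ grade y z g) (f' : Hom x y),
    d x z (comp f f') = comp (d y z f) f' +
      (if GradingParity.parity g = 0 then (1 : k) else -1) • comp f (d x y f')

namespace DGCategory

attribute [instance] DGCategory.addCommGroup DGCategory.module

variable {k : Type w'} [CommRing k] {G : Type w} [AddCommGroupWithOne G] [GradingParity G]

/-- The full dg subcategory on a set of objects. -/
def full (A : DGCategory.{u, v} k G) (S : Set A.Obj) : DGCategory.{u, v} k G where
  Obj := S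
  Hom x y := A.Hom x y
  grade x y := A.grade x y
  grade_isInternal x y := A.grade_isInternal x y
  d x y := A.d x y
  comp := A.comp
  one x := A.one x
  comp_assoc := A.comp_assoc
  one_comp := A.one_comp
  comp_one := A.comp_one
  one_mem x := A.one_mem x
  comp_mem := A.comp_mem
  d_mem := A.d_mem
  d_d := A.d_d
  d_comp := A.d_comp

variable (A : DGCategory.{u, v} k G)

/-- The sign `(-1) ^ p`. -/
def sgn (k : Type w') [CommRing k] (p : ZMod 2) : k := if p = 0 then 1 else -1

/-- The parity of a degree. -/
abbrev par (g : G) : ZMod 2 := GradingParity.parity g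

section homogeneous

/-- Composition of homogeneous morphisms. -/
def hcomp {x y z : A.Obj} {g h : G} (a : A.grade y z g) (b : A.grade x y h) :
    A.grade x z (g + h) := ⟨A.comp (a : A.Hom y z) (b : A.Hom x y), A.comp_mem a.2 b.2⟩

/-- Differential of a homogeneous morphism. -/
def hd {x y : A.Obj} {g : G} (a : A.grade x y g) : A.grade x y (g + 1) :=
  ⟨A.d x y a, A.d_mem a.2⟩

/-- The identity as a homogeneous morphism. -/
def hone (x : A.Obj) : A.grade x x (0 : G) := ⟨A.one x, A.one_mem x⟩

end homogeneous

/-- `BarWord t s`: words `[a₁|…|aₙ]` of homogeneous morphisms for which the composite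
`a₁ ∘ ⋯ ∘ aₙ : s → t` makes sense. -/
inductive BarWord : A.Obj → A.Obj → Type (max u v w)
  | nil {x : A.Obj} : BarWord x x
  | cons {t y s : A.Obj} {g : G} (a : A.grade y t g) (p : BarWord y s) : BarWord t s

namespace BarWord

variable {A}

/-- Concatenation of words. -/
def append : ∀ {t y s : A.Obj}, BarWord A t y → BarWord A y s → BarWord A t s
  | _, _, _, nil, r => r
  | _, _, _, cons a p, r => cons a (append p r)

/-- The degree `|a₁| - 1 + ⋯ + |aₙ| - 1`. -/
def deg : ∀ {t s : A.Obj}, BarWord A t s → G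
  | _, _, nil => 0
  | _, _, cons (g := g) _ p => g - 1 + deg p

/-- All the ways to write a word as a concatenation `q ++ r`. -/
def splits : ∀ {t s : A.Obj}, BarWord A t s → List (Σ y, BarWord A t y × BarWord A y s)
  | t, _, nil => [⟨t, nil, nil⟩]
  | t, _, cons a p =>
      ⟨t, nil, cons a p⟩ :: (splits p).map fun z => ⟨z.1, cons a z.2.1, z.2.2⟩

/-- The word `[a|…|a]` with `n` letters. -/
def rep {x : A.Obj} {g : G} (a : A.grade x x g) : ℕ → BarWord A x x
  | 0 => nil
  | n + 1 => cons a (rep a n)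

end BarWord

/-- Cyclically composable words `a₀[a₁|…|aₙ]` of homogeneous morphisms, `n ≥ 0`. -/
structure HWord where
  {cod : A.Obj}
  {dom : A.Obj}
  {g : G}
  head : A.grade dom cod g
  tail : BarWord A dom cod

namespace HWord

variable {A}

/-- The degree `|a₀| + (|a₁| - 1) + ⋯ + (|aₙ| - 1)`. -/
def deg (c : HWord A) : G := c.g + c.tail.deg

end HWord

/-- The relations of the normalized Hochschild chains: `a₀[a₁|…|aₙ]` is `k`-linear in each
letter, and it vanishes if `aᵢ` is an identity for some `i ≥ 1`. -/
inductive Rel : (HWord A →₀ k) → Prop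
  | head {x y : A.Obj} {g : G} (c : k) (a a' : A.grade x y g) (p : BarWord A x y) :
      Rel (.single ⟨c • a + a', p⟩ 1 - c • .single ⟨a, p⟩ 1 - .single ⟨a', p⟩ 1)
  | tail {x y t s : A.Obj} {g h : G} (a₀ : A.grade x y g) (q : BarWord A x t)
      (c : k) (a a' : A.grade s t h) (r : BarWord A s y) :
      Rel (.single ⟨a₀, q.append (.cons (c • a + a') r)⟩ 1
        - c • .single ⟨a₀, q.append (.cons a r)⟩ 1 - .single ⟨a₀, q.append (.cons a' r)⟩ 1)
  | unit {x y t : A.Obj} {g : G} (a₀ : A.grade x y g) (q : BarWord A x t)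
      (r : BarWord A t y) :
      Rel (.single ⟨a₀, q.append (.cons (A.hone t) r)⟩ 1)

/-- The submodule generated by the relations. -/
noncomputable def relSubmodule : Submodule k (HWord A →₀ k) := Submodule.span k {z | A.Rel z}

/-- The normalized Hochschild chains
`C̄ A = ⨁ Hom(x₁, x₀) ⊗ s(Hom(x₂, x₁)/k·1) ⊗ ⋯ ⊗ s(Hom(x₀, xₙ)/k·1)`, the sum over all `n ≥ 0`
and all `x₀, …, xₙ` (with `k·1` to be read as `0` where source and target differ),
presented by generators and relations. -/
abbrev NormChain : Type _ := (HWord A →₀ k) ⧸ A.relSubmodule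

/-- The class of the word `a₀[a₁|…|aₙ]`. -/
noncomputable def cls {x y : A.Obj} {g : G} (a₀ : A.grade x y g) (p : BarWord A x y) : A.NormChain :=
  A.relSubmodule.mkQ (.single ⟨a₀, p⟩ 1)

/-- For `[a₁|…|aₙ] = q ++ r` the part of `b (a₀[a₁|…|aₙ])` that is indexed by the first
letter `aⱼ` of `r`. It consists of the term with `d aⱼ`, with the sign
`(-1) ^ (|a₀| + |a₁| + ⋯ + |aⱼ₋₁| - j)`, and of
* `(-1) ^ (|a₀| + ⋯ + |aⱼ| - j) a₀[…|aⱼ aⱼ₊₁|…]` if `j < n`,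
* `- (-1) ^ ((|aₙ| - 1) (|a₀| + ⋯ + |aₙ₋₁| - (n - 1))) aₙ a₀[a₁|…|aₙ₋₁]` if `j = n`. -/
noncomputable def bPart {x y : A.Obj} {g : G} (a₀ : A.grade x y g) :
    ∀ {t : A.Obj}, BarWord A x t → BarWord A t y → A.NormChain
  | _, _, .nil => 0
  | _, q, .cons (g := h) a .nil =>
      sgn k (par g + par q.deg + 1) • A.cls a₀ (q.append (.cons (A.hd a) .nil))
      - sgn k ((par h + 1) * (par g + par q.deg)) • A.cls (A.hcomp a a₀) q
  | _, q, .cons (g := h) a (.cons a' r) =>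
      sgn k (par g + par q.deg + 1) • A.cls a₀ (q.append (.cons (A.hd a) (.cons a' r)))
      + sgn k (par g + par q.deg + par h + 1) • A.cls a₀ (q.append (.cons (A.hcomp a a') r))

/-- The part of `b (a₀[a₁|…|aₙ])` that is not in `bPart`: the terms `d a₀[a₁|…|aₙ]` and, if
`n ≥ 1`, `(-1) ^ |a₀| a₀ a₁[a₂|…|aₙ]`. -/
noncomputable def bHead {x y : A.Obj} {g : G} (a₀ : A.grade x y g) : BarWord A x y → A.NormChain
  | .nil => A.cls (A.hd a₀) .nil
  | .cons a p => A.cls (A.hd a₀) (.cons a p) + sgn k (par g) • A.cls (A.hcomp a₀ a) p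

/-- The Hochschild differential on a word. -/
noncomputable def bWord {x y : A.Obj} {g : G} (a₀ : A.grade x y g) (p : BarWord A x y) : A.NormChain :=
  A.bHead a₀ p + (p.splits.map fun z => A.bPart a₀ z.2.1 z.2.2).sum

/-- The term `± 1[aₗ|…|aₙ|a₀|…|aₗ₋₁]` of `B (a₀[a₁|…|aₙ])`, for `q = [a₁|…|aₗ₋₁]` and
`r = [aₗ|…|aₙ]`; the sign is
`(-1) ^ ((|a₀| + ⋯ + |aₗ₋₁| - l) (|aₗ| + ⋯ + |aₙ| - (n - l + 1)))`. -/
noncomputable def BPart {x y : A.Obj} {g : G} (a₀ : A.grade x y g) {t : A.Obj}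
    (q : BarWord A x t) (r : BarWord A t y) : A.NormChain :=
  sgn k ((par g + 1 + par q.deg) * par r.deg) • A.cls (A.hone t) (r.append (.cons a₀ q))

/-- Connes' operator on a word: the sum of the terms above over all `n + 1` cyclic
rotations of `a₀, …, aₙ`. -/
noncomputable def BWord {x y : A.Obj} {g : G} (a₀ : A.grade x y g) (p : BarWord A x y) : A.NormChain :=
  (p.splits.map fun z => A.BPart a₀ z.2.1 z.2.2).sum

/-! ### The operators are well defined -/

section wellDefined

variable {A}

/-- Linearity of a map to chains, in one condition. -/
def IsLin {M V : Type*} [AddCommGroup M] [Module k M] [AddCommGroup V] [Module k V]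
    (f : M → V) : Prop := ∀ (c : k) (a a' : M), f (c • a + a') = c • f a + f a'

lemma IsLin.add {M V : Type*} [AddCommGroup M] [Module k M] [AddCommGroup V] [Module k V]
    {f f' : M → V} (hf : IsLin (k := k) f) (hf' : IsLin (k := k) f') :
    IsLin (k := k) fun a => f a + f' a := by
  intro c a a'; simp only [hf c a a', hf' c a a', smul_add]; abel

lemma IsLin.sub {M V : Type*} [AddCommGroup M] [Module k M] [AddCommGroup V] [Module k V]
    {f f' : M → V} (hf : IsLin (k := k) f) (hf' : IsLin (k := k) f') :
    IsLin (k := k) fun a => f a - f' a := by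
  intro c a a'; simp only [hf c a a', hf' c a a', smul_sub]; abel

lemma IsLin.smul {M V : Type*} [AddCommGroup M] [Module k M] [AddCommGroup V] [Module k V]
    {f : M → V} (s : k) (hf : IsLin (k := k) f) : IsLin (k := k) fun a => s • f a := by
  intro c a a'; simp only [hf c a a', smul_add, smul_comm s c]

lemma IsLin.zero {M V : Type*} [AddCommGroup M] [Module k M] [AddCommGroup V]
    [Module k V] : IsLin (k := k) fun _ : M => (0 : V) := by
  intro c a a'; simp

lemma IsLin.sum {M V ι : Type*} [AddCommGroup M] [Module k M] [AddCommGroup V]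
    [Module k V] (l : List ι) {f : ι → M → V} (hf : ∀ i, IsLin (k := k) (f i)) :
    IsLin (k := k) fun a => (l.map fun i => f i a).sum := by
  induction l with
  | nil => simpa using IsLin.zero
  | cons i l ih => simpa using (hf i).add ih

lemma IsLin.comp' {M M' V : Type*} [AddCommGroup M] [Module k M] [AddCommGroup M']
    [Module k M'] [AddCommGroup V] [Module k V] {f : M' → V} {e : M → M'}
    (hf : IsLin (k := k) f) (he : IsLin (k := k) e) : IsLin (k := k) fun a => f (e a) := by
  intro c a a'; simp only [he c a a', hf c]

lemma isLin_hd {x y : A.Obj} {g : G} :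
    IsLin (k := k) fun a : A.grade x y g => A.hd a := by
  intro c a a'; ext; simp [hd]

lemma isLin_hcomp_left {x y z : A.Obj} {g h : G} (b : A.grade x y h) :
    IsLin (k := k) fun a : A.grade y z g => A.hcomp a b := by
  intro c a a'; ext; simp [hcomp]

lemma isLin_hcomp_right {x y z : A.Obj} {g h : G} (a : A.grade y z g) :
    IsLin (k := k) fun b : A.grade x y h => A.hcomp a b := by
  intro c b b'; ext; simp [hcomp]

lemma isLin_cls_head {x y : A.Obj} {g : G} (p : BarWord A x y) :
    IsLin (k := k) fun a : A.grade x y g => A.cls a p := by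
  intro c a a'
  have := (Submodule.Quotient.mk_eq_zero A.relSubmodule).2
    (Submodule.subset_span (Rel.head c a a' p))
  simp only [cls]
  rw [← sub_eq_zero, ← map_smul, ← sub_sub, ← map_sub, ← map_sub]
  exact this

lemma isLin_cls_tail {x y t s : A.Obj} {g h : G} (a₀ : A.grade x y g)
    (q : BarWord A x t) (r : BarWord A s y) :
    IsLin (k := k) fun a : A.grade s t h => A.cls a₀ (q.append (.cons a r)) := by
  intro c a a'
  have := (Submodule.Quotient.mk_eq_zero A.relSubmodule).2
    (Submodule.subset_span (Rel.tail a₀ q c a a' r))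
  simp only [cls]
  rw [← sub_eq_zero, ← map_smul, ← sub_sub, ← map_sub, ← map_sub]
  exact this

lemma cls_unit {x y t : A.Obj} {g : G} (a₀ : A.grade x y g) (q : BarWord A x t)
    (r : BarWord A t y) : A.cls a₀ (q.append (.cons (A.hone t) r)) = 0 :=
  (Submodule.Quotient.mk_eq_zero A.relSubmodule).2 (Submodule.subset_span (Rel.unit a₀ q r))

namespace BarWord

@[simp] lemma nil_append {t s : A.Obj} (r : BarWord A t s) : nil.append r = r := rfl

@[simp] lemma cons_append {t t' y s : A.Obj} {g : G} (a : A.grade t t' g) (p : BarWord A t y)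
    (r : BarWord A y s) : (cons a p).append r = cons a (p.append r) := rfl

@[simp] lemma append_nil {t s : A.Obj} (p : BarWord A t s) : p.append nil = p := by
  induction p with
  | nil => rfl
  | cons a p ih => rw [cons_append, ih]

lemma append_assoc {t y z s : A.Obj} (p : BarWord A t y) (q : BarWord A y z)
    (r : BarWord A z s) : (p.append q).append r = p.append (q.append r) := by
  induction p with
  | nil => rfl
  | cons a p ih => simp only [cons_append, ih]

lemma deg_append {t y s : A.Obj} (p : BarWord A t y) (q : BarWord A y s) :
    (p.append q).deg = p.deg + q.deg := by
  induction p with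
  | nil => simp [deg]
  | cons a p ih => simp only [cons_append, deg, ih, add_assoc]

/-- The splittings of `q₀ ++ [a] ++ r₀`: the letter `a` lies on the right or on the left. -/
lemma sum_splits_append {V : Type*} [AddCommGroup V] {t y z s : A.Obj} {g : G}
    (q₀ : BarWord A t y) (a : A.grade z y g) (r₀ : BarWord A z s)
    (F : ∀ w, BarWord A t w → BarWord A w s → V) :
    ((q₀.append (cons a r₀)).splits.map fun z => F z.1 z.2.1 z.2.2).sum
      = (q₀.splits.map fun z => F z.1 z.2.1 (z.2.2.append (cons a r₀))).sum
        + (r₀.splits.map fun z => F z.1 (q₀.append (cons a z.2.1)) z.2.2).sum := by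
  induction q₀ with
  | nil => simp [splits, Function.comp_def]
  | cons c q ih =>
    simp only [cons_append, splits, List.map_cons, List.map_map, List.sum_cons,
      Function.comp_def]
    rw [ih a fun w p r => F w (cons c p) r, add_assoc]

/-- A telescoping sum over the splittings. -/
lemma sum_splits_telescope {V : Type*} [AddCommGroup V] {t s : A.Obj}
    (p : BarWord A t s) (F : ∀ w, BarWord A t w → BarWord A w s → V)
    (h₂ : ∀ {w x y : A.Obj} {g h : G} (q : BarWord A t w) (c : A.grade x w g)
      (e : A.grade y x h) (r : BarWord A y s), F w q (cons c (cons e r)) = 0)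
    (h₁ : ∀ {w : A.Obj} {g : G} (q : BarWord A t w) (c : A.grade s w g),
      F w q (cons c nil) + F s (q.append (cons c nil)) nil = 0) :
    (p.splits.map fun z => F z.1 z.2.1 z.2.2).sum
      = match t, s, p, F with
        | _, _, nil, F => F _ nil nil
        | _, _, cons _ _, _ => 0 := by
  induction p with
  | nil => simp [splits]
  | cons a p ih =>
    simp only [splits, List.map_cons, List.map_map, List.sum_cons, Function.comp_def]
    rw [ih (fun w q r => F w (cons a q) r) (fun q c e r => h₂ (cons a q) c e r)
      (fun q c => h₁ (cons a q) c)]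
    cases p with
    | nil => simpa using h₁ nil a
    | cons e r => simpa using h₂ nil a e r

end BarWord


lemma sgn_add (p q : ZMod 2) : sgn k (p + q) = sgn k p * sgn k q := by
  have h : ∀ p : ZMod 2, p = 0 ∨ p = 1 := by decide
  rcases h p with rfl | rfl <;> rcases h q with rfl | rfl <;>
    simp [sgn, show (1 + 1 : ZMod 2) = 0 from rfl]

lemma sgn_one : sgn k 1 = -1 := by simp [sgn]

lemma sgn_zero : sgn k 0 = 1 := by simp [sgn]

lemma d_one (x : A.Obj) : A.d x x (A.one x) = 0 := by
  have h := A.d_comp (A.one_mem x) (A.one x)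
  rw [A.comp_one, A.comp_one, A.one_comp] at h
  simpa using h

lemma cls_congr {x y : A.Obj} {g g' : G} {a : A.grade x y g} {a' : A.grade x y g'}
    (hg : g = g') (ha : (a : A.Hom x y) = a') (p : BarWord A x y) : A.cls a p = A.cls a' p := by
  subst hg; obtain rfl := Subtype.ext ha; rfl

lemma cls_tail_congr {x y t s : A.Obj} {g h h' : G} (a₀ : A.grade x y g)
    {a : A.grade s t h} {a' : A.grade s t h'} (hh : h = h') (ha : (a : A.Hom s t) = a')
    (q : BarWord A x t) (r : BarWord A s y) :
    A.cls a₀ (q.append (.cons a r)) = A.cls a₀ (q.append (.cons a' r)) := by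
  subst hh; obtain rfl := Subtype.ext ha; rfl

lemma cls_head_zero {x y : A.Obj} {g : G} {a : A.grade x y g} (ha : (a : A.Hom x y) = 0)
    (p : BarWord A x y) : A.cls a p = 0 := by
  obtain rfl : a = 0 := Subtype.ext ha
  have := isLin_cls_head (A := A) (g := g) p (1 : k) 0 0
  simp only [smul_zero, add_zero, one_smul] at this
  exact left_eq_add.1 this

lemma cls_tail_zero {x y t s : A.Obj} {g h : G} (a₀ : A.grade x y g)
    {a : A.grade s t h} (ha : (a : A.Hom s t) = 0)
    (q : BarWord A x t) (r : BarWord A s y) : A.cls a₀ (q.append (.cons a r)) = 0 := by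
  obtain rfl : a = 0 := Subtype.ext ha
  have := isLin_cls_tail (A := A) (h := h) a₀ q r (1 : k) 0 0
  simp only [smul_zero, add_zero, one_smul] at this
  exact left_eq_add.1 this

/-- A slot to the left of a letter. -/
lemma isLin_cls_left {x y t s z : A.Obj} {g h : G} (a₀ : A.grade x y g)
    (q : BarWord A x t) (r : BarWord A s z) (r' : BarWord A z y) :
    IsLin (k := k) fun a : A.grade s t h => A.cls a₀ ((q.append (.cons a r)).append r') := by
  simp only [BarWord.append_assoc, BarWord.cons_append]
  exact isLin_cls_tail a₀ q _

lemma cls_unit_left {x y t z : A.Obj} {g : G} (a₀ : A.grade x y g)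
    (q : BarWord A x t) (r : BarWord A t z) (r' : BarWord A z y) :
    A.cls a₀ ((q.append (.cons (A.hone t) r)).append r') = 0 := by
  simp only [BarWord.append_assoc, BarWord.cons_append]
  exact cls_unit a₀ q _

/-- A slot two letters into the right part. -/
lemma isLin_cls_right {x y t s z w : A.Obj} {g h l : G} (a₀ : A.grade x y g)
    (q : BarWord A x t) (c : A.grade w t l) (r : BarWord A w z) (r' : BarWord A s y) :
    IsLin (k := k) fun a : A.grade s z h =>
      A.cls a₀ (q.append (.cons c (r.append (.cons a r')))) := by
  have := isLin_cls_tail (A := A) (h := h) a₀ (q.append (.cons c r)) r'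
  simpa only [BarWord.append_assoc, BarWord.cons_append] using this

lemma cls_unit_right {x y t z w : A.Obj} {g l : G} (a₀ : A.grade x y g)
    (q : BarWord A x t) (c : A.grade w t l) (r : BarWord A w z) (r' : BarWord A z y) :
    A.cls a₀ (q.append (.cons c (r.append (.cons (A.hone z) r')))) = 0 := by
  have := cls_unit (A := A) a₀ (q.append (.cons c r)) r'
  simpa only [BarWord.append_assoc, BarWord.cons_append] using this

lemma isLin_bPart_head {x y t : A.Obj} {g : G} (q : BarWord A x t) (r : BarWord A t y) :
    IsLin (k := k) fun a₀ : A.grade x y g => A.bPart a₀ q r := by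
  match r with
  | .nil => simpa only [bPart] using IsLin.zero
  | .cons a .nil =>
    simp only [bPart]
    exact ((isLin_cls_head _).smul _).sub
      (((isLin_cls_head q).comp' (isLin_hcomp_right a)).smul _)
  | .cons a (.cons a' r) =>
    simp only [bPart]
    exact ((isLin_cls_head _).smul _).add ((isLin_cls_head _).smul _)

lemma isLin_bPart_left {x y t s z : A.Obj} {g h : G} (a₀ : A.grade x y g)
    (q : BarWord A x t) (q' : BarWord A s z) (r : BarWord A z y) :
    IsLin (k := k) fun a : A.grade s t h => A.bPart a₀ (q.append (.cons a q')) r := by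
  rcases r with _ | ⟨e, _ | ⟨e', r⟩⟩
  · simpa only [bPart] using IsLin.zero
  · simp only [bPart, BarWord.deg_append, BarWord.deg]
    exact ((isLin_cls_left _ _ _ _).smul _).sub ((isLin_cls_tail _ _ _).smul _)
  · simp only [bPart, BarWord.deg_append, BarWord.deg]
    exact ((isLin_cls_left _ _ _ _).smul _).add ((isLin_cls_left _ _ _ _).smul _)

lemma isLin_bPart_right {x y t s z : A.Obj} {g h : G} (a₀ : A.grade x y g)
    (q : BarWord A x t) (r : BarWord A t z) (r' : BarWord A s y) :
    IsLin (k := k) fun a : A.grade s z h => A.bPart a₀ q (r.append (.cons a r')) := by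
  match r with
  | .nil =>
    cases r' with
    | nil =>
      simp only [BarWord.nil_append, bPart]
      exact (((isLin_cls_tail a₀ q _).comp' isLin_hd).smul _).sub
        (((isLin_cls_head q).comp' (isLin_hcomp_left a₀)).smul _)
    | cons e r' =>
      simp only [BarWord.nil_append, bPart]
      exact (((isLin_cls_tail a₀ q _).comp' isLin_hd).smul _).add
        (((isLin_cls_tail a₀ q _).comp' (isLin_hcomp_left e)).smul _)
  | .cons c .nil =>
    simp only [BarWord.nil_append, BarWord.cons_append, bPart]
    exact ((isLin_cls_right a₀ q (A.hd c) .nil r').smul _).add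
      (((isLin_cls_tail a₀ q _).comp' (isLin_hcomp_right c)).smul _)
  | .cons c (.cons e r) =>
    simp only [BarWord.cons_append, bPart]
    exact ((isLin_cls_right a₀ q (A.hd c) (.cons e r) r').smul _).add
      ((isLin_cls_right a₀ q (A.hcomp c e) r r').smul _)

lemma isLin_bWord_head {x y : A.Obj} {g : G} (p : BarWord A x y) :
    IsLin (k := k) fun a₀ : A.grade x y g => A.bWord a₀ p := by
  refine IsLin.add ?_ (IsLin.sum _ fun z => isLin_bPart_head _ _)
  cases p with
  | nil => exact (isLin_cls_head _).comp' isLin_hd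
  | cons a p =>
    exact ((isLin_cls_head _).comp' isLin_hd).add
      (((isLin_cls_head p).comp' (isLin_hcomp_left a)).smul _)

lemma isLin_bWord_tail {x y t s : A.Obj} {g h : G} (a₀ : A.grade x y g)
    (q : BarWord A x t) (r : BarWord A s y) :
    IsLin (k := k) fun a : A.grade s t h => A.bWord a₀ (q.append (.cons a r)) := by
  simp only [bWord, BarWord.sum_splits_append (F := fun w q r => A.bPart a₀ q r)]
  refine IsLin.add ?_ (IsLin.add (IsLin.sum _ fun z => isLin_bPart_right _ _ _ _)
    (IsLin.sum _ fun z => isLin_bPart_left _ _ _ _))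
  cases q with
  | nil =>
    exact (isLin_cls_tail (A.hd a₀) .nil r).add
      (((isLin_cls_head r).comp' (isLin_hcomp_right a₀)).smul _)
  | cons c q =>
    exact (isLin_cls_tail (A.hd a₀) (.cons c q) r).add
      ((isLin_cls_tail (A.hcomp a₀ c) q r).smul _)

lemma bPart_left_unit {x y t z : A.Obj} {g : G} (a₀ : A.grade x y g)
    (q : BarWord A x t) (q' : BarWord A t z) (r : BarWord A z y) :
    A.bPart a₀ (q.append (.cons (A.hone t) q')) r = 0 := by
  rcases r with _ | ⟨e, _ | ⟨e', r⟩⟩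
  · simp only [bPart]
  · simp only [bPart, cls_unit_left, cls_unit, smul_zero, sub_zero]
  · simp only [bPart, cls_unit_left, smul_zero, add_zero]

lemma bPart_right_unit_two {x y t s z w : A.Obj} {g h l : G} (a₀ : A.grade x y g)
    (q : BarWord A x t) (c : A.grade w t h) (e : A.grade z w l) (r : BarWord A z s)
    (r' : BarWord A s y) :
    A.bPart a₀ q ((BarWord.cons c (.cons e r)).append (.cons (A.hone s) r')) = 0 := by
  have h₁ := cls_unit_right a₀ q (A.hd c) (.cons e r) r'
  have h₂ := cls_unit_right a₀ q (A.hcomp c e) r r'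
  simp only [BarWord.cons_append] at h₁ ⊢
  simp only [bPart, h₁, h₂, smul_zero, add_zero]

lemma bPart_right_unit_one {x y t w : A.Obj} {g h : G} (a₀ : A.grade x y g)
    (q : BarWord A x t) (c : A.grade w t h) (r' : BarWord A w y) :
    A.bPart a₀ q ((BarWord.cons c .nil).append (.cons (A.hone w) r'))
      = sgn k (par g + par q.deg + par h + 1) • A.cls a₀ (q.append (.cons c r')) := by
  have h₁ := cls_unit_right a₀ q (A.hd c) .nil r'
  simp only [BarWord.nil_append] at h₁
  simp only [BarWord.cons_append, BarWord.nil_append, bPart, h₁, smul_zero, zero_add]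
  rw [cls_tail_congr a₀ (a := A.hcomp c (A.hone w)) (a' := c) (add_zero _) (A.comp_one _)]

lemma bPart_right_unit_zero {x y t : A.Obj} {g : G} (a₀ : A.grade x y g)
    (q : BarWord A x t) (r' : BarWord A t y) :
    A.bPart a₀ q (.cons (A.hone t) r')
      = - sgn k (par g + par q.deg) • A.cls a₀ (q.append r') := by
  cases r' with
  | nil =>
    simp only [bPart, cls_tail_zero a₀ (a := A.hd (A.hone _)) (A.d_one _), smul_zero, zero_sub,
      BarWord.append_nil]
    rw [cls_congr (a := A.hcomp (A.hone _) a₀) (a' := a₀) (zero_add _) (A.one_comp _)]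
    simp [par]
  | cons e r' =>
    simp only [bPart, cls_tail_zero a₀ (a := A.hd (A.hone _)) (A.d_one _), smul_zero, zero_add]
    rw [cls_tail_congr a₀ (a := A.hcomp (A.hone _) e) (a' := e) (zero_add _) (A.one_comp _)]
    simp [par, sgn_add, sgn_one]

lemma bWord_unit {x y t : A.Obj} {g : G} (a₀ : A.grade x y g) (q : BarWord A x t)
    (r : BarWord A t y) : A.bWord a₀ (q.append (.cons (A.hone t) r)) = 0 := by
  have key := BarWord.sum_splits_telescope q
    (fun w p p' => A.bPart a₀ p (p'.append (.cons (A.hone t) r)))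
    (fun p c e p' => bPart_right_unit_two a₀ p c e p' r)
    (fun {w h} p c => by
      rw [bPart_right_unit_one]
      simp only [BarWord.nil_append, bPart_right_unit_zero,
        BarWord.append_assoc, BarWord.cons_append, BarWord.deg_append, BarWord.deg]
      rw [← add_smul]
      have : par (p.deg + (h - 1 + 0)) = par p.deg + par h + 1 := by
        simp only [par, map_add, map_sub, GradingParity.parity_one, add_zero,
          CharTwo.sub_eq_add, add_assoc]
      rw [this]
      simp only [sgn_add, sgn_one, mul_neg, mul_one, mul_assoc, neg_neg,
        neg_add_cancel, zero_smul])
  simp only [bWord, BarWord.sum_splits_append (F := fun w q r => A.bPart a₀ q r), key,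
    bPart_left_unit]
  cases q with
  | nil =>
    have h₁ := cls_unit (A.hd a₀) .nil r
    simp only [BarWord.nil_append] at h₁
    simp only [BarWord.nil_append, bHead, h₁, zero_add, bPart_right_unit_zero, BarWord.deg]
    rw [cls_congr (a := A.hcomp a₀ (A.hone _)) (a' := a₀) (add_zero _) (A.comp_one _)]
    simp [par]
  | cons c q =>
    have h₁ := cls_unit (A.hd a₀) (.cons c q) r
    simp only [BarWord.cons_append] at h₁
    simp [bHead, h₁, cls_unit]

lemma isLin_BPart_left {x y t s z : A.Obj} {g h : G} (a₀ : A.grade x y g)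
    (q : BarWord A x t) (q' : BarWord A s z) (r : BarWord A z y) :
    IsLin (k := k) fun a : A.grade s t h => A.BPart a₀ (q.append (.cons a q')) r := by
  simp only [BPart, BarWord.deg_append, BarWord.deg]
  have := isLin_cls_tail (A := A) (h := h) (A.hone z) (r.append (.cons a₀ q)) q'
  simp only [BarWord.append_assoc, BarWord.cons_append] at this
  exact this.smul _

lemma isLin_BPart_right {x y t s z : A.Obj} {g h : G} (a₀ : A.grade x y g)
    (q : BarWord A x t) (r : BarWord A t z) (r' : BarWord A s y) :
    IsLin (k := k) fun a : A.grade s z h => A.BPart a₀ q (r.append (.cons a r')) := by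
  simp only [BPart, BarWord.deg_append, BarWord.deg]
  exact (isLin_cls_left _ _ _ _).smul _

lemma isLin_BWord_head {x y : A.Obj} {g : G} (p : BarWord A x y) :
    IsLin (k := k) fun a₀ : A.grade x y g => A.BWord a₀ p :=
  IsLin.sum _ fun _ => (isLin_cls_tail _ _ _).smul _

lemma isLin_BWord_tail {x y t s : A.Obj} {g h : G} (a₀ : A.grade x y g)
    (q : BarWord A x t) (r : BarWord A s y) :
    IsLin (k := k) fun a : A.grade s t h => A.BWord a₀ (q.append (.cons a r)) := by
  simp only [BWord, BarWord.sum_splits_append (F := fun w q r => A.BPart a₀ q r)]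
  exact IsLin.add (IsLin.sum _ fun z => isLin_BPart_right _ _ _ _)
    (IsLin.sum _ fun z => isLin_BPart_left _ _ _ _)

lemma BWord_unit {x y t : A.Obj} {g : G} (a₀ : A.grade x y g) (q : BarWord A x t)
    (r : BarWord A t y) : A.BWord a₀ (q.append (.cons (A.hone t) r)) = 0 := by
  have h₁ : ∀ {z : A.Obj} (p : BarWord A x z) (p' : BarWord A z t),
      A.BPart a₀ p (p'.append (.cons (A.hone t) r)) = 0 := fun p p' => by
    simp only [BPart, cls_unit_left, smul_zero]
  have h₂ : ∀ {z : A.Obj} (p : BarWord A t z) (p' : BarWord A z y),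
      A.BPart a₀ (q.append (.cons (A.hone t) p)) p' = 0 := fun {z} p p' => by
    have := cls_unit (A.hone z) (p'.append (.cons a₀ q)) p
    simp only [BarWord.append_assoc, BarWord.cons_append] at this
    simp only [BPart, this, smul_zero]
  simp only [BWord, BarWord.sum_splits_append (F := fun w q r => A.BPart a₀ q r), h₁, h₂]
  simp

/-- A map on words that is linear in every letter and vanishes on words with an identity in a
position `≥ 1` is compatible with the relations. -/
lemma relSubmodule_le_ker {V : Type*} [AddCommGroup V] [Module k V]
    (f : ∀ {x y : A.Obj} {g : G}, A.grade x y g → BarWord A x y → V)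
    (hhead : ∀ {x y : A.Obj} {g : G} (p : BarWord A x y),
      IsLin (k := k) fun a : A.grade x y g => f a p)
    (htail : ∀ {x y t s : A.Obj} {g h : G} (a₀ : A.grade x y g) (q : BarWord A x t)
      (r : BarWord A s y), IsLin (k := k) fun a : A.grade s t h => f a₀ (q.append (.cons a r)))
    (hunit : ∀ {x y t : A.Obj} {g : G} (a₀ : A.grade x y g) (q : BarWord A x t)
      (r : BarWord A t y), f a₀ (q.append (.cons (A.hone t) r)) = 0) :
    A.relSubmodule ≤ LinearMap.ker
      (Finsupp.linearCombination k fun c : HWord A => f c.head c.tail) := by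
  refine Submodule.span_le.2 ?_
  rintro z (⟨c, a, a', p⟩ | ⟨a₀, q, c, a, a', r⟩ | ⟨a₀, q, r⟩)
  · simpa [sub_sub, sub_eq_zero] using hhead p c a a'
  · simpa [sub_sub, sub_eq_zero] using htail a₀ q r c a a'
  · simpa using hunit a₀ q r

end wellDefined

/-- The Hochschild differential `b` on the normalized chains. -/
noncomputable def b : A.NormChain →ₗ[k] A.NormChain :=
  A.relSubmodule.liftQ (Finsupp.linearCombination k fun c : HWord A => A.bWord c.head c.tail)
    (relSubmodule_le_ker (fun a p => A.bWord a p) isLin_bWord_head isLin_bWord_tail bWord_unit)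

/-- Connes' operator `B` on the normalized chains. -/
noncomputable def B : A.NormChain →ₗ[k] A.NormChain :=
  A.relSubmodule.liftQ (Finsupp.linearCombination k fun c : HWord A => A.BWord c.head c.tail)
    (relSubmodule_le_ker (fun a p => A.BWord a p) isLin_BWord_head isLin_BWord_tail BWord_unit)

@[simp] lemma b_cls {x y : A.Obj} {g : G} (a₀ : A.grade x y g) (p : BarWord A x y) :
    A.b (A.cls a₀ p) = A.bWord a₀ p := by simp [b, cls]

@[simp] lemma B_cls {x y : A.Obj} {g : G} (a₀ : A.grade x y g) (p : BarWord A x y) :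
    A.B (A.cls a₀ p) = A.BWord a₀ p := by simp [B, cls]

/-- The normalized chains of degree `g`. -/
noncomputable def chainDeg (g : G) : Submodule k A.NormChain :=
  Submodule.span k {z | ∃ c : HWord A, c.deg = g ∧ z = A.cls c.head c.tail}

/-- The `k[[u]]`-module `C̄ A [[u]]`: a sequence `z` stands for `∑ i, z i * u ^ i`. -/
abbrev NegChain : Type _ := ℕ → A.NormChain

/-- The elements of degree `g` of `C̄ A [[u]]`, where `u` has degree `2`. -/
noncomputable def negDeg (g : G) : Submodule k A.NegChain :=
  Submodule.pi Set.univ fun i : ℕ => A.chainDeg (g - ((2 * i : ℕ) : G))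

/-- Multiplication by `u` on `C̄ A [[u]]`. -/
noncomputable def uMul : A.NegChain →ₗ[k] A.NegChain where
  toFun z i := match i with
    | 0 => 0
    | i + 1 => z i
  map_add' z z' := by ext i; cases i <;> simp
  map_smul' c z := by ext i; cases i <;> simp

/-- The differential `b + u B` of the normalized negative cyclic complex `C̄ A [[u]]`. -/
noncomputable def negDiff : A.NegChain →ₗ[k] A.NegChain :=
  A.b.compLeft ℕ + A.uMul ∘ₗ A.B.compLeft ℕ

/-- The cycles of degree `g` of the normalized negative cyclic complex. -/
def IsNegCycle (g : G) (z : A.NegChain) : Prop := z ∈ A.negDeg g ∧ A.negDiff z = 0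

/-- Two elements of degree `g` of the normalized negative cyclic complex differ by the boundary
of an element of degree `g - 1` (the differential has degree `1`). -/
def NegHomologous (g : G) (z z' : A.NegChain) : Prop :=
  ∃ w ∈ A.negDeg (g - 1), A.negDiff w = z - z'

/-- The element `1_P` of `C̄ A [[u]]`, concentrated in `u`-degree `0`. -/
noncomputable def oneCycle (P : A.Obj) : A.NegChain := Pi.single 0 (A.cls (A.hone P) .nil)

/-- The element
`η_π = π + ∑_{i ≥ 1} (-1) ^ i ((2 i)! / (2 (i!))) (2 π - 1_N)[π|…|π] u ^ i` of `C̄ A [[u]]`, with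
`2 i` copies of `π`. The natural number division is exact, see `two_mul_factorial_dvd`. -/
noncomputable def eta (N : A.Obj) (π : A.grade N N (0 : G)) : A.NegChain
  | 0 => A.cls π .nil
  | i + 1 =>
      ((-1) ^ (i + 1) * (((2 * (i + 1)).factorial / (2 * (i + 1).factorial) : ℕ) : k)) •
        A.cls ((2 : k) • π - A.hone N) (BarWord.rep π (2 * (i + 1)))

lemma two_mul_factorial_dvd (i : ℕ) :
    2 * (i + 1).factorial ∣ (2 * (i + 1)).factorial := by
  rw [show 2 * (i + 1) = 2 * i + 1 + 1 by ring, Nat.factorial_succ (2 * i + 1),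
    Nat.factorial_succ i, show 2 * i + 1 + 1 = 2 * (i + 1) by ring, ← mul_assoc]
  exact mul_dvd_mul_left _ (Nat.factorial_dvd_factorial (by lia))

lemma comp_mem_zero {x y z : A.Obj} {f : A.Hom y z} {f' : A.Hom x y}
    (hf : f ∈ A.grade y z 0) (hf' : f' ∈ A.grade x y 0) : A.comp f f' ∈ A.grade x z 0 := by
  simpa using A.comp_mem hf hf'

end DGCategory

/-! Only `i`, `j`, the identities and their composites and linear combinations enter. All are closed
of degree 0, so on words in them the internal differential drops out, `b` is the ordinary
alternating sum of faces, and all signs depend only on word lengths.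

These morphisms form a separable situation. Put `e = 1 ⊗ 1` at `P` and `e = i ⊗ j + (1 - π) ⊗ (1 -
π)` at `N`. Then `e` multiplies to the identity at both objects and commutes with `i` and `j`, as `j
i = 1` gives `j (1 - π) = 0` and `(1 - π) i = 0`. Inserting `e` behind the head, `h (a₀[a₁|…]) = ∑
a₀ u[v|a₁|…]`, therefore satisfies `b h + h b = id` on words of positive length whose tail letters
commute with `e` (`b_insertion_add_insertion_b`).

Hence a negative cyclic cycle `ζ` on such words is a boundary once `ζ 0` is a Hochschild boundary:
from `b w₀ = ζ 0` solve `b w_{m+1} = ζ_{m+1} - B w_m` by `w_{m+1} = h (ζ_{m+1} - B w_m)`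
(`exists_negDiff_eq`). The right side is a `b`-cycle because `b B = - B b` and `B² = 0`. For `ζ =
1_P - η_π` the start is `w₀ = j[i]`, with `b (j[i]) = j i - i j = 1_P - π`. No division occurs, so
the characteristic plays no role.

That `η_π` is a cycle follows from `b ((2π - 1)[π|…|π]) = 1[π|…|π]` for `2m + 2` letters `π`, from
the multiple of `1[π|…|π]` that `B` produces, and from a recursion for the coefficients
(`negDiff_eta`). -/

namespace DGCategory

/-! ### Closed morphisms of degree 0 and their words -/

section closedWords

variable {k : Type w'} [CommRing k] {G : Type w} [AddCommGroupWithOne G] [GradingParity G]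
variable (A : DGCategory.{u, v} k G)

/-- The closed morphisms of degree `0`. -/
def ClosedHom (x y : A.Obj) : Submodule k (A.Hom x y) :=
  A.grade x y 0 ⊓ LinearMap.ker (A.d x y)

variable {A}

lemma comp_mem_closedHom {x y z : A.Obj} {f : A.Hom y z} {f' : A.Hom x y}
    (hf : f ∈ A.ClosedHom y z) (hf' : f' ∈ A.ClosedHom x y) :
    A.comp f f' ∈ A.ClosedHom x z := by
  refine ⟨A.comp_mem_zero hf.1 hf'.1, ?_⟩
  have h₁ : A.d _ _ f = 0 := hf.2
  have h₂ : A.d _ _ f' = 0 := hf'.2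
  change A.d _ _ (A.comp f f') = 0
  rw [A.d_comp hf.1, h₁, h₂]
  simp

lemma one_mem_closedHom (x : A.Obj) : A.one x ∈ A.ClosedHom x x := ⟨A.one_mem x, A.d_one x⟩

namespace ClosedHom

/-- Composition of closed morphisms of degree `0`, as a bilinear map. -/
def comp {x y z : A.Obj} : A.ClosedHom y z →ₗ[k] A.ClosedHom x y →ₗ[k] A.ClosedHom x z :=
  LinearMap.mk₂ k
    (fun f f' => ⟨A.comp (f : A.Hom y z) (f' : A.Hom x y), comp_mem_closedHom f.2 f'.2⟩)
    (fun _ _ _ => by ext; simp) (fun _ _ _ => by ext; simp)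
    (fun _ _ _ => by ext; simp) (fun _ _ _ => by ext; simp)

variable (A) in
/-- The identity as a closed morphism of degree `0`. -/
def one (x : A.Obj) : A.ClosedHom x x := ⟨A.one x, one_mem_closedHom x⟩

/-- A closed morphism of degree `0` as a homogeneous morphism. -/
def toGrade {x y : A.Obj} (a : A.ClosedHom x y) : A.grade x y (0 : G) := ⟨a.1, a.2.1⟩

lemma comp_assoc {w x y z : A.Obj} (f : A.ClosedHom y z) (g : A.ClosedHom x y)
    (h : A.ClosedHom w x) : comp (comp f g) h = comp f (comp g h) :=
  Subtype.ext (A.comp_assoc _ _ _)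

@[simp] lemma one_comp {x y : A.Obj} (f : A.ClosedHom x y) : comp (one A y) f = f :=
  Subtype.ext (A.one_comp _)

@[simp] lemma comp_one {x y : A.Obj} (f : A.ClosedHom x y) : comp f (one A x) = f :=
  Subtype.ext (A.comp_one _)

lemma d_eq_zero {x y : A.Obj} (f : A.ClosedHom x y) : A.d x y f = 0 := f.2.2

end ClosedHom

variable (A) in
/-- Composable words of closed morphisms of degree `0`. -/
inductive ZWord : A.Obj → A.Obj → Type (max u v)
  | nil {x : A.Obj} : ZWord x x
  | cons {t y s : A.Obj} (a : A.ClosedHom y t) (p : ZWord y s) : ZWord t s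

namespace ZWord

/-- Concatenation of words. -/
def append : ∀ {t y s : A.Obj}, ZWord A t y → ZWord A y s → ZWord A t s
  | _, _, _, nil, r => r
  | _, _, _, cons a p, r => cons a (append p r)

/-- The number of letters. -/
def length : ∀ {t s : A.Obj}, ZWord A t s → ℕ
  | _, _, nil => 0
  | _, _, cons _ p => length p + 1

/-- The underlying word of homogeneous morphisms. -/
def toBar : ∀ {t s : A.Obj}, ZWord A t s → BarWord A t s
  | _, _, nil => .nil
  | _, _, cons a p => .cons (ClosedHom.toGrade a) (toBar p)

/-- All letters of the word satisfy the predicate `C`. -/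
def All (C : ∀ {x y : A.Obj}, A.ClosedHom x y → Prop) : ∀ {t s : A.Obj}, ZWord A t s → Prop
  | _, _, nil => True
  | _, _, cons a p => C a ∧ All C p

@[simp] lemma nil_append {t s : A.Obj} (r : ZWord A t s) : nil.append r = r := rfl

@[simp] lemma cons_append {t t' y s : A.Obj} (a : A.ClosedHom t t') (p : ZWord A t y)
    (r : ZWord A y s) : (cons a p).append r = cons a (p.append r) := rfl

@[simp] lemma append_nil {t s : A.Obj} (p : ZWord A t s) : p.append nil = p := by
  induction p with
  | nil => rfl
  | cons a p ih => rw [cons_append, ih]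

lemma append_assoc {t y z s : A.Obj} (p : ZWord A t y) (q : ZWord A y z)
    (r : ZWord A z s) : (p.append q).append r = p.append (q.append r) := by
  induction p with
  | nil => rfl
  | cons a p ih => simp only [cons_append, ih]

@[simp] lemma length_nil {x : A.Obj} : (nil : ZWord A x x).length = 0 := rfl

@[simp] lemma length_cons {t y s : A.Obj} (a : A.ClosedHom y t) (p : ZWord A y s) :
    (cons a p).length = p.length + 1 := rfl

@[simp] lemma length_append {t y s : A.Obj} (p : ZWord A t y) (q : ZWord A y s) :
    (p.append q).length = p.length + q.length := by
  induction p with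
  | nil => simp
  | cons a p ih => simp only [cons_append, length_cons, ih]; ring

@[simp] lemma toBar_append {t y s : A.Obj} (p : ZWord A t y) (q : ZWord A y s) :
    (p.append q).toBar = p.toBar.append q.toBar := by
  induction p with
  | nil => rfl
  | cons a p ih => simp only [cons_append, toBar, ih, BarWord.cons_append]

lemma deg_toBar {t s : A.Obj} (p : ZWord A t s) : p.toBar.deg = -(p.length : G) := by
  induction p with
  | nil => simp [toBar, BarWord.deg]
  | cons a p ih => simp only [toBar, BarWord.deg, ih, length_cons]; push_cast; abel

lemma All.append {C : ∀ {x y : A.Obj}, A.ClosedHom x y → Prop} {t y s : A.Obj}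
    {p : ZWord A t y} {q : ZWord A y s} (hp : p.All C) (hq : q.All C) : (p.append q).All C := by
  induction p with
  | nil => exact hq
  | cons a p ih => exact ⟨hp.1, ih hp.2 hq⟩

/-! ### Sums over the end letters, faces and splittings of a word -/

variable {V V' : Type*} [AddCommGroup V] [AddCommGroup V']

/-- The value of `f` at the first letter and the rest of a word; `0` for the empty word. -/
def firstTerm : ∀ {t s : A.Obj}, ZWord A t s →
    (∀ y, A.ClosedHom y t → ZWord A y s → V) → V
  | _, _, nil, _ => 0
  | _, _, cons a p, f => f _ a p

/-- The value of `f` at the last letter and the word before it; `0` for the empty word. -/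
def lastTerm : ∀ {t s : A.Obj}, ZWord A t s →
    (∀ y, ZWord A t y → A.ClosedHom s y → V) → V
  | _, _, nil, _ => 0
  | _, _, cons a nil, f => f _ nil a
  | _, _, cons a (cons a' r), f => lastTerm (cons a' r) fun y q c => f y (cons a q) c

/-- The alternating sum of `f` over the words in which two adjacent letters are composed. -/
def mergeSum : ∀ {t s : A.Obj}, ZWord A t s → (ZWord A t s → V) → V
  | _, _, nil, _ => 0
  | _, _, cons _ nil, _ => 0
  | _, _, cons a (cons a' r), f =>
      f (cons (ClosedHom.comp a a') r) - mergeSum (cons a' r) fun q => f (cons a q)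

/-- The sum of `f` over all ways to write a word as a concatenation. -/
def sumSplits : ∀ {t s : A.Obj}, ZWord A t s →
    (∀ y, ZWord A t y → ZWord A y s → V) → V
  | _, _, nil, f => f _ nil nil
  | _, _, cons a p, f => f _ nil (cons a p) + sumSplits p fun y q r => f y (cons a q) r

/-- In this and the next three congruence lemmas the length is handed to the comparison because the
signs to be rewritten are powers of `-1` with lengths in the exponent: once constant, they can be
pulled out of the sum. -/
lemma lastTerm_congr {t s : A.Obj} (p : ZWord A t s)
    {f g : ∀ y, ZWord A t y → A.ClosedHom s y → V}
    (h : ∀ y q a, q.length + 1 = p.length → f y q a = g y q a) :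
    p.lastTerm f = p.lastTerm g := by
  induction p with
  | nil => rfl
  | cons a p ih =>
    cases p with
    | nil => exact h _ _ _ rfl
    | cons a' r =>
      exact ih fun y q c hq => h y (cons a q) c (by simpa using hq)

lemma firstTerm_congr {t s : A.Obj} (p : ZWord A t s)
    {f g : ∀ y, A.ClosedHom y t → ZWord A y s → V}
    (h : ∀ y a q, q.length + 1 = p.length → f y a q = g y a q) :
    p.firstTerm f = p.firstTerm g := by
  cases p with
  | nil => rfl
  | cons a p => exact h _ _ _ rfl

lemma mergeSum_congr {t s : A.Obj} (p : ZWord A t s) {f g : ZWord A t s → V}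
    (h : ∀ q, q.length + 1 = p.length → f q = g q) : p.mergeSum f = p.mergeSum g := by
  induction p with
  | nil => rfl
  | cons a p ih =>
    cases p with
    | nil => rfl
    | cons a' r =>
      simp only [mergeSum]
      rw [h _ (by simp), ih fun q hq => h (cons a q) (by simpa using hq)]

lemma sumSplits_congr {t s : A.Obj} (p : ZWord A t s)
    {f g : ∀ y, ZWord A t y → ZWord A y s → V}
    (h : ∀ y q r, q.length + r.length = p.length → f y q r = g y q r) :
    p.sumSplits f = p.sumSplits g := by
  induction p with
  | nil => exact h _ _ _ rfl
  | cons a p ih =>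
    simp only [sumSplits]
    rw [h _ _ _ (by simp), ih fun y q r hq => h y (cons a q) r (by simp; omega)]

lemma sumSplits_add {t s : A.Obj} (p : ZWord A t s)
    (f g : ∀ y, ZWord A t y → ZWord A y s → V) :
    p.sumSplits (fun y q r => f y q r + g y q r) = p.sumSplits f + p.sumSplits g := by
  induction p with
  | nil => rfl
  | cons a p ih => simp only [sumSplits, ih]; abel

lemma sumSplits_sub {t s : A.Obj} (p : ZWord A t s)
    (f g : ∀ y, ZWord A t y → ZWord A y s → V) :
    p.sumSplits (fun y q r => f y q r - g y q r) = p.sumSplits f - p.sumSplits g := by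
  induction p with
  | nil => rfl
  | cons a p ih => simp only [sumSplits, ih]; abel

lemma sumSplits_zero {t s : A.Obj} (p : ZWord A t s) :
    p.sumSplits (fun _ _ _ => (0 : V)) = 0 := by
  induction p with
  | nil => rfl
  | cons a p ih => simp only [sumSplits, ih, add_zero]

lemma mergeSum_add {t s : A.Obj} (p : ZWord A t s) (f g : ZWord A t s → V) :
    p.mergeSum (fun q => f q + g q) = p.mergeSum f + p.mergeSum g := by
  induction p with
  | nil => simp [mergeSum]
  | cons a p ih =>
    cases p with
    | nil => simp [mergeSum]
    | cons a' r => simp only [mergeSum, ih]; abel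

/-- The condition is on the length because `q = nil` does not typecheck for a variable endpoint of
`q`. -/
lemma sumSplits_left_nil {t s : A.Obj} (p : ZWord A t s) (f : ZWord A t s → V) :
    p.sumSplits (fun _ q r => if q.length = 0 then f (q.append r) else 0) = f p := by
  cases p <;> simp [sumSplits, sumSplits_zero]

lemma sumSplits_right_nil {t s : A.Obj} (p : ZWord A t s) (f : ZWord A t s → V) :
    p.sumSplits (fun _ q r => if r.length = 0 then f (q.append r) else 0) = f p := by
  induction p with
  | nil => simp [sumSplits]
  | cons a p ih => simpa [sumSplits] using ih fun w => f (cons a w)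

/-- The right side has one more splitting, the one with empty `q`; there `firstTerm` takes its
default value `0`. The same happens with empty `r` in `lastTerm_sumSplits`. -/
lemma firstTerm_sumSplits {t s : A.Obj} (p : ZWord A t s)
    (f : ∀ x y, A.ClosedHom x t → ZWord A x y → ZWord A y s → V) :
    (p.firstTerm fun x a p' => p'.sumSplits fun y q r => f x y a q r)
      = p.sumSplits fun y q r => q.firstTerm fun x a q' => f x y a q' r := by
  cases p <;> simp [firstTerm, sumSplits]

lemma lastTerm_cons {t y s : A.Obj} (a : A.ClosedHom y t) (p : ZWord A y s) (hp : p.length ≠ 0)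
    (f : ∀ y, ZWord A t y → A.ClosedHom s y → V) :
    (cons a p).lastTerm f = p.lastTerm fun y q c => f y (cons a q) c := by
  cases p with
  | nil => simp at hp
  | cons a' r => rfl

lemma lastTerm_add {t s : A.Obj} (p : ZWord A t s)
    (f g : ∀ y, ZWord A t y → A.ClosedHom s y → V) :
    p.lastTerm (fun y q a => f y q a + g y q a) = p.lastTerm f + p.lastTerm g := by
  induction p with
  | nil => simp [lastTerm]
  | cons a p ih =>
    cases p with
    | nil => simp [lastTerm]
    | cons a' r => simp only [lastTerm, ih]

lemma lastTerm_sumSplits {t s : A.Obj} (p : ZWord A t s)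
    (f : ∀ x y, ZWord A t y → ZWord A y x → A.ClosedHom s x → V) :
    (p.lastTerm fun x p' a => p'.sumSplits fun y q r => f x y q r a)
      = p.sumSplits fun y q r => r.lastTerm fun x r' a => f x y q r' a := by
  induction p with
  | nil => simp [lastTerm, sumSplits]
  | cons a p ih =>
    cases p with
    | nil => simp [lastTerm, sumSplits]
    | cons a' r =>
      rw [sumSplits, ← ih fun x y q r c => f x y (cons a q) r c]
      exact lastTerm_add (cons a' r) _ _

/-- Both sides are the sum over the letters of the word. -/
lemma sumSplits_firstTerm {t s : A.Obj} (p : ZWord A t s)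
    (f : ∀ x y, ZWord A t x → A.ClosedHom y x → ZWord A y s → V) :
    (p.sumSplits fun x q r => r.firstTerm fun y c r' => f x y q c r')
      = p.sumSplits fun y q r => q.lastTerm fun x q' c => f x y q' c r := by
  induction p with
  | nil => rfl
  | cons a p ih =>
    have h := ih fun x y q c r => f x y (cons a q) c r
    rw [sumSplits, sumSplits, h]
    cases p with
    | nil => simp [sumSplits, firstTerm, lastTerm]
    | cons a' r => simp [sumSplits, firstTerm, lastTerm]

lemma lastTerm_append_cons {t x y s : A.Obj} (r : ZWord A t y) (a : A.ClosedHom x y)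
    (q : ZWord A x s) (f : ∀ y, ZWord A t y → A.ClosedHom s y → V) :
    (r.append (cons a q)).lastTerm f
      = (cons a q).lastTerm fun y q' c => f y (r.append q') c := by
  induction r with
  | nil => rfl
  | cons c r ih => rw [cons_append, lastTerm_cons _ _ (by simp), ih]; rfl

variable [Module k V] [Module k V']

lemma map_firstTerm (L : V →ₗ[k] V') {t s : A.Obj} (p : ZWord A t s)
    (f : ∀ y, A.ClosedHom y t → ZWord A y s → V) :
    L (p.firstTerm f) = p.firstTerm fun y a q => L (f y a q) := by
  cases p <;> simp [firstTerm]

lemma map_lastTerm (L : V →ₗ[k] V') {t s : A.Obj} (p : ZWord A t s)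
    (f : ∀ y, ZWord A t y → A.ClosedHom s y → V) :
    L (p.lastTerm f) = p.lastTerm fun y q a => L (f y q a) := by
  induction p with
  | nil => simp [lastTerm]
  | cons a p ih =>
    cases p with
    | nil => simp [lastTerm]
    | cons a' r => simp only [lastTerm, ih]

lemma map_mergeSum (L : V →ₗ[k] V') {t s : A.Obj} (p : ZWord A t s) (f : ZWord A t s → V) :
    L (p.mergeSum f) = p.mergeSum fun q => L (f q) := by
  induction p with
  | nil => simp [mergeSum]
  | cons a p ih =>
    cases p with
    | nil => simp [mergeSum]
    | cons a' r => simp only [mergeSum, map_sub, ih]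

lemma map_sumSplits (L : V →ₗ[k] V') {t s : A.Obj} (p : ZWord A t s)
    (f : ∀ y, ZWord A t y → ZWord A y s → V) :
    L (p.sumSplits f) = p.sumSplits fun y q r => L (f y q r) := by
  induction p with
  | nil => simp [sumSplits]
  | cons a p ih => simp only [sumSplits, map_add, ih]

/-- After a merge and a cut the merged letter lies in one of the two parts, so cutting can be done
before merging. A pair inside `r` comes `q.length` places later than in `r` alone, whence the sign.
-/
lemma mergeSum_sumSplits {t s : A.Obj} (p : ZWord A t s)
    (f : ∀ y, ZWord A t y → ZWord A y s → V) :
    (p.mergeSum fun p' => p'.sumSplits f)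
      = p.sumSplits fun y q r => (q.mergeSum fun q' => f y q' r)
        + (-1 : k) ^ q.length • r.mergeSum fun r' => f y q r' := by
  induction p with
  | nil => simp [mergeSum, sumSplits]
  | cons a p ih =>
    cases p with
    | nil => simp [mergeSum, sumSplits]
    | cons a' r =>
      have h := ih fun y q r => f y (cons a q) r
      -- The splittings with both `a` and `a'` on the left: there the merge of `a` with `a'` splits
      -- off from the later merges.
      have hr : (r.sumSplits fun y q r' =>
            ((cons a (cons a' q)).mergeSum fun q' => f y q' r')
              + (-1 : k) ^ (q.length + 1 + 1) • r'.mergeSum fun r'' => f y (cons a (cons a' q)) r'')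
          = (r.sumSplits fun y q r' => f y (cons (ClosedHom.comp a a') q) r')
            - r.sumSplits fun y q r' => ((cons a' q).mergeSum fun q' => f y (cons a q') r')
              + (-1 : k) ^ (q.length + 1) • r'.mergeSum fun r'' => f y (cons a (cons a' q)) r'' := by
        rw [← sumSplits_sub]
        refine sumSplits_congr r fun y q r' _ => ?_
        simp only [mergeSum, pow_succ]
        module
      rw [sumSplits, sumSplits]
      simp only [mergeSum, length_cons, length_nil] at h hr ⊢
      have h' : ((cons a' r).mergeSum fun q => (cons a q).sumSplits f) = _ :=
        (mergeSum_add _ _ _).trans (congrArg _ h)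
      rw [hr, h', sumSplits, sumSplits]
      simp only [mergeSum, length_cons, length_nil]
      module

/-- The adjacent pairs are those inside `r`, the last letter of `r` with `a`, `a` with the first
letter of `q`, and those inside `q`. The second kind sits at place `r.length - 1`, counted from 0;
its sign is written `- (-1) ^ r.length` to avoid subtraction. -/
lemma mergeSum_append_cons {t x y s : A.Obj} (r : ZWord A t y) (a : A.ClosedHom x y)
    (q : ZWord A x s) (f : ZWord A t s → V) :
    (r.append (cons a q)).mergeSum f
      = (r.mergeSum fun r' => f (r'.append (cons a q)))
        - (-1 : k) ^ r.length •
          (r.lastTerm fun _ r' c => f (r'.append (cons (ClosedHom.comp c a) q)))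
        + (-1 : k) ^ r.length •
          (q.firstTerm fun _ c q' => f (r.append (cons (ClosedHom.comp a c) q')))
        - (-1 : k) ^ r.length • q.mergeSum fun q' => f (r.append (cons a q')) := by
  induction r with
  | nil => cases q <;> simp [mergeSum, firstTerm, lastTerm]
  | cons c r ih =>
    cases r with
    | nil =>
      have := ih a (fun w => f (cons c w))
      simp only [cons_append, nil_append, mergeSum, lastTerm, length_cons, length_nil] at this ⊢
      rw [this]; simp; abel
    | cons c' r =>
      have := ih a (fun w => f (cons c w))
      simp only [cons_append, mergeSum, lastTerm, length_cons] at this ⊢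
      rw [this]; simp only [pow_succ]; module

end ZWord

end closedWords

end DGCategory

/-! ### The operators `b` and `B` on closed words and the mixed complex relations -/

namespace DGCategory

section closedWords

variable {k : Type w'} [CommRing k] {G : Type w} [AddCommGroupWithOne G] [GradingParity G]
variable {A : DGCategory.{u, v} k G}

open ZWord

/-- The class of a cyclically composable word of closed morphisms of degree `0`. -/
noncomputable def zcls {x y : A.Obj} (a₀ : A.ClosedHom x y) (p : ZWord A x y) : A.NormChain :=
  A.cls (ClosedHom.toGrade a₀) p.toBar

/-- A map that is linear in the sense of `IsLin`, as a linear map. -/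
def IsLin.toLinearMap {M V : Type*} [AddCommGroup M] [Module k M] [AddCommGroup V] [Module k V]
    {f : M → V} (hf : IsLin (k := k) f) : M →ₗ[k] V :=
  have h0 : f 0 = 0 := by simpa using hf 1 0 0
  { toFun := f
    map_add' a a' := by simpa using hf 1 a a'
    map_smul' c a := by simpa [h0] using hf c a 0 }

/-- The class of a word, as a linear map in the head. -/
noncomputable def zclsHead {x y : A.Obj} (p : ZWord A x y) : A.ClosedHom x y →ₗ[k] A.NormChain :=
  (isLin_cls_head p.toBar).toLinearMap ∘ₗ Submodule.inclusion inf_le_left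

@[simp] lemma zclsHead_apply {x y : A.Obj} (p : ZWord A x y) (a₀ : A.ClosedHom x y) :
    zclsHead p a₀ = zcls a₀ p := rfl

/-- The class of a word, as a linear map in the first letter of the tail. -/
noncomputable def zclsCons {x y t : A.Obj} (a₀ : A.ClosedHom x y) (p : ZWord A t y) :
    A.ClosedHom t x →ₗ[k] A.NormChain :=
  (isLin_cls_tail (ClosedHom.toGrade a₀) .nil p.toBar).toLinearMap ∘ₗ
    Submodule.inclusion inf_le_left

@[simp] lemma zclsCons_apply {x y t : A.Obj} (a₀ : A.ClosedHom x y) (p : ZWord A t y)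
    (a : A.ClosedHom t x) : zclsCons a₀ p a = zcls a₀ (cons a p) := rfl

lemma zcls_one_letter {x y t : A.Obj} (a₀ : A.ClosedHom x y) (q : ZWord A x t)
    (r : ZWord A t y) : zcls a₀ (q.append (cons (ClosedHom.one A t) r)) = 0 := by
  rw [zcls, toBar_append]
  exact cls_unit _ _ _

lemma sgn_natCast (n : ℕ) : sgn k (n : ZMod 2) = (-1) ^ n := by
  induction n with
  | zero => simp [sgn_zero]
  | succ n ih => rw [Nat.cast_succ, sgn_add, ih, sgn_one, pow_succ]

lemma par_deg_toBar {t s : A.Obj} (p : ZWord A t s) : par p.toBar.deg = (p.length : ZMod 2) := by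
  rw [deg_toBar, par, map_neg, ZMod.neg_eq_self_mod_two]
  induction p.length with
  | zero => simp
  | succ n ih => rw [Nat.cast_succ, map_add, ih, GradingParity.parity_one, Nat.cast_succ]

lemma sum_splits_toBar {V : Type*} [AddCommGroup V] {t s : A.Obj} (p : ZWord A t s)
    (F : ∀ w, BarWord A t w → BarWord A w s → V) :
    (p.toBar.splits.map fun z => F z.1 z.2.1 z.2.2).sum
      = p.sumSplits fun y q r => F y q.toBar r.toBar := by
  induction p with
  | nil => simp [toBar, BarWord.splits, sumSplits]
  | cons a p ih =>
    simp only [toBar, BarWord.splits, List.map_cons, List.map_map, List.sum_cons,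
      Function.comp_def, sumSplits]
    rw [ih fun w q r => F w (.cons (ClosedHom.toGrade a) q) r]

theorem B_zcls {x y : A.Obj} (a₀ : A.ClosedHom x y) (p : ZWord A x y) :
    A.B (zcls a₀ p) = p.sumSplits fun t q r =>
      (-1 : k) ^ ((q.length + 1) * r.length) •
        zcls (ClosedHom.one A t) (r.append (cons a₀ q)) := by
  rw [zcls, B_cls, BWord, sum_splits_toBar (F := fun _ q r => A.BPart _ q r)]
  refine sumSplits_congr p fun t q r _ => ?_
  rw [BPart, par_deg_toBar, par_deg_toBar, zcls, toBar_append, ← sgn_natCast]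
  congr 2
  simp [par, add_comm]

/-- The prefix `q` makes the induction run: the letter just treated is moved to its end. Terms with
`d` vanish as the letters are closed, each letter but the last gives a merge, and the last one gives
the cyclic term. -/
lemma sumSplits_bPart {x y : A.Obj} (a₀ : A.ClosedHom x y) {t : A.Obj} (p : ZWord A t y)
    (q : ZWord A x t) :
    (p.sumSplits fun _ q' r => A.bPart (ClosedHom.toGrade a₀) (q.append q').toBar r.toBar)
      = - (-1 : k) ^ q.length • (p.mergeSum fun p' => zcls a₀ (q.append p'))
        + (-1 : k) ^ (q.length + p.length) •
          p.lastTerm fun _ q' a => zcls (ClosedHom.comp a a₀) (q.append q') := by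
  induction p with
  | nil => simp [sumSplits, mergeSum, lastTerm, toBar, bPart]
  | cons a p ih =>
    have h := ih a₀ (q.append (cons a .nil))
    simp only [append_assoc, cons_append, nil_append, length_append, length_cons,
      length_nil] at h
    rw [sumSplits, h, append_nil]
    cases p with
    | nil =>
      simp only [toBar, bPart, mergeSum, lastTerm, append_nil, length_cons, length_nil,
        cls_tail_zero (ClosedHom.toGrade a₀) (a := A.hd (ClosedHom.toGrade a))
          (ClosedHom.d_eq_zero a)]
      rw [cls_congr (a := A.hcomp (ClosedHom.toGrade a) (ClosedHom.toGrade a₀))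
        (a' := ClosedHom.toGrade (ClosedHom.comp a a₀)) (add_zero 0) rfl, par_deg_toBar,
        show ((par (0 : G) + 1) * (par (0 : G) + (q.length : ZMod 2))) = q.length by simp [par],
        sgn_natCast, zcls]
      module
    | cons a' r =>
      simp only [toBar, bPart, mergeSum, lastTerm, length_cons,
        cls_tail_zero (ClosedHom.toGrade a₀) (a := A.hd (ClosedHom.toGrade a))
          (ClosedHom.d_eq_zero a)]
      rw [cls_tail_congr (a := A.hcomp (ClosedHom.toGrade a) (ClosedHom.toGrade a'))
        (a' := ClosedHom.toGrade (ClosedHom.comp a a')) _ (add_zero 0) rfl, par_deg_toBar,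
        show ((par (0 : G) + (q.length : ZMod 2) + par (0 : G) + 1)) = (q.length + 1 : ℕ) by
          simp [par],
        sgn_natCast]
      have : zcls a₀ (q.append (cons (ClosedHom.comp a a') r)) = A.cls (ClosedHom.toGrade a₀)
          (q.toBar.append (.cons (ClosedHom.toGrade (ClosedHom.comp a a')) r.toBar)) := by
        rw [zcls, toBar_append, toBar]
      rw [← this]
      module

/-- Every letter of the tail has shifted degree `-1`, so the Koszul signs reduce to the alternating
signs of the classical Hochschild boundary. -/
theorem b_zcls {x y : A.Obj} (a₀ : A.ClosedHom x y) (p : ZWord A x y) :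
    A.b (zcls a₀ p) = (p.firstTerm fun _ c q => zcls (ClosedHom.comp a₀ c) q)
      - (p.mergeSum fun q => zcls a₀ q)
      + (-1 : k) ^ p.length • p.lastTerm fun _ q a => zcls (ClosedHom.comp a a₀) q := by
  have h := sumSplits_bPart a₀ p .nil
  simp only [nil_append, length_nil, pow_zero, zero_add] at h
  have h0 : ∀ p, A.cls (A.hd (ClosedHom.toGrade a₀)) p = 0 :=
    cls_head_zero (ClosedHom.d_eq_zero a₀)
  rw [zcls, b_cls, bWord, sum_splits_toBar (F := fun _ q r => A.bPart _ q r), h]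
  cases p with
  | nil => simp [toBar, bHead, firstTerm, mergeSum, lastTerm, h0]
  | cons a p =>
    simp only [toBar, bHead, firstTerm, h0]
    rw [cls_congr (a := A.hcomp (ClosedHom.toGrade a₀) (ClosedHom.toGrade a))
      (a' := ClosedHom.toGrade (ClosedHom.comp a₀ a)) (add_zero 0) rfl, par, map_zero, sgn_zero,
      zcls]
    module

lemma lastTerm_smul {V : Type*} [AddCommGroup V] [Module k V] {t s : A.Obj} (p : ZWord A t s)
    (c : k) (f : ∀ y, ZWord A t y → A.ClosedHom s y → V) :
    (p.lastTerm fun y q a => c • f y q a) = c • p.lastTerm f :=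
  (map_lastTerm (c • LinearMap.id : V →ₗ[k] V) p f).symm

lemma firstTerm_smul {V : Type*} [AddCommGroup V] [Module k V] {t s : A.Obj} (p : ZWord A t s)
    (c : k) (f : ∀ y, A.ClosedHom y t → ZWord A y s → V) :
    (p.firstTerm fun y a q => c • f y a q) = c • p.firstTerm f :=
  (map_firstTerm (c • LinearMap.id : V →ₗ[k] V) p f).symm

lemma mergeSum_smul {V : Type*} [AddCommGroup V] [Module k V] {t s : A.Obj} (p : ZWord A t s)
    (c : k) (f : ZWord A t s → V) : (p.mergeSum fun q => c • f q) = c • p.mergeSum f :=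
  (map_mergeSum (c • LinearMap.id : V →ₗ[k] V) p f).symm

lemma sumSplits_smul {V : Type*} [AddCommGroup V] [Module k V] {t s : A.Obj} (p : ZWord A t s)
    (c : k) (f : ∀ y, ZWord A t y → ZWord A y s → V) :
    (p.sumSplits fun y q r => c • f y q r) = c • p.sumSplits f :=
  (map_sumSplits (c • LinearMap.id : V →ₗ[k] V) p f).symm

/-- The inner faces of the words in `B (a₀[p])` are the words of `- B` of the faces of `a₀[p]`. -/
theorem B_b_zcls {x y : A.Obj} (a₀ : A.ClosedHom x y) (p : ZWord A x y) :
    A.B (A.b (zcls a₀ p)) = p.sumSplits fun t q r =>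
      (-1 : k) ^ ((q.length + 1) * r.length) •
        (r.append (cons a₀ q)).mergeSum fun p' => zcls (ClosedHom.one A t) p' := by
  rw [b_zcls, map_add, map_sub, map_smul, map_firstTerm, map_mergeSum, map_lastTerm]
  simp only [B_zcls]
  rw [firstTerm_sumSplits p fun x y c q r => (-1 : k) ^ ((q.length + 1) * r.length) •
      zcls (ClosedHom.one A y) (r.append (cons (ClosedHom.comp a₀ c) q)),
    lastTerm_sumSplits p fun x y q r a => (-1 : k) ^ ((q.length + 1) * r.length) •
      zcls (ClosedHom.one A y) (r.append (cons (ClosedHom.comp a a₀) q)),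
    mergeSum_sumSplits, ← sumSplits_smul, ← sumSplits_sub, ← sumSplits_add]
  -- For a fixed splitting the four groups of `mergeSum_append_cons` match the faces `a a₀`, `a₀ c`
  -- and the inner faces of `r` and `q`; only signs remain.
  refine sumSplits_congr p fun t q r hqr => ?_
  rw [mergeSum_append_cons,
    firstTerm_congr q (g := fun _ c q' => (-1 : k) ^ (q.length * r.length) •
      zcls (ClosedHom.one A t) (r.append (cons (ClosedHom.comp a₀ c) q')))
      (fun _ _ _ h => by rw [h]), firstTerm_smul,
    mergeSum_congr q (g := fun q' => (-1 : k) ^ (q.length * r.length) •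
      zcls (ClosedHom.one A t) (r.append (cons a₀ q'))) (fun _ h => by rw [h]), mergeSum_smul,
    -- Here `r'` has length `r.length - 1`. Only the parity counts, so `r.length + 1` replaces it
    -- and no natural subtraction appears.
    mergeSum_congr r (g := fun r' => (-1 : k) ^ ((q.length + 1) * (r.length + 1)) •
      zcls (ClosedHom.one A t) (r'.append (cons a₀ q)))
      (fun r' h => by rw [← h, add_assoc, mul_add, pow_add]; simp), mergeSum_smul,
    lastTerm_congr r (g := fun _ r' c => (-1 : k) ^ ((q.length + 1) * (r.length + 1)) •
      zcls (ClosedHom.one A t) (r'.append (cons (ClosedHom.comp c a₀) q)))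
      (fun _ r' _ h => by rw [← h, add_assoc, mul_add, pow_add]; simp), lastTerm_smul, ← hqr]
  simp only [pow_add, pow_mul, mul_add, add_mul, mul_one, one_mul, pow_one]
  rcases neg_one_pow_eq_or k q.length with hq | hq <;>
    rcases neg_one_pow_eq_or k r.length with hr | hr <;> simp only [hq, hr] <;> module

/-- The inner faces of the words of `B (a₀[p])` make up `- B b` by `B_b_zcls`. The two outer faces
absorb the head `1` and leave cyclic rotations of `a₀[p]`; each rotation occurs twice, as the first
face of one word and the last face of another, with opposite signs. -/
theorem b_B_zcls {x y : A.Obj} (a₀ : A.ClosedHom x y) (p : ZWord A x y) :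
    A.b (A.B (zcls a₀ p)) = - A.B (A.b (zcls a₀ p)) := by
  have h₁ : ∀ {t : A.Obj} (q : ZWord A x t) (r : ZWord A t y),
      ((r.append (cons a₀ q)).firstTerm fun _ c w => zcls c w)
        = (if r.length = 0 then zcls a₀ (q.append r) else 0)
          + r.firstTerm fun _ c r' => zcls c (r'.append (cons a₀ q)) := by
    intro t q r
    cases r <;> simp [firstTerm]
  have h₂ : ∀ {t : A.Obj} (q : ZWord A x t) (r : ZWord A t y),
      ((r.append (cons a₀ q)).lastTerm fun _ w c => zcls c w)
        = (if q.length = 0 then zcls a₀ (q.append r) else 0)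
          + q.lastTerm fun _ q' c => zcls c (r.append (cons a₀ q')) := by
    intro t q r
    rw [lastTerm_append_cons]
    cases q <;> simp [lastTerm]
  have h : ∀ (t) (q : ZWord A x t) (r : ZWord A t y), q.length + r.length = p.length →
      A.b ((-1 : k) ^ ((q.length + 1) * r.length) •
        zcls (ClosedHom.one A t) (r.append (cons a₀ q)))
      + (-1 : k) ^ ((q.length + 1) * r.length) •
        ((r.append (cons a₀ q)).mergeSum fun p' => zcls (ClosedHom.one A t) p')
      = ((if r.length = 0 then zcls a₀ (q.append r) else 0)
          - (if q.length = 0 then zcls a₀ (q.append r) else 0))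
        + ((r.firstTerm fun _ c r' =>
            (-1 : k) ^ ((q.length + 1) * (r'.length + 1)) • zcls c (r'.append (cons a₀ q)))
          - q.lastTerm fun _ q' c =>
            (-1 : k) ^ ((q'.length + 1) * (r.length + 1)) • zcls c (r.append (cons a₀ q'))) := by
    intro t q r _
    -- The sign is `1` wherever the indicator is nonzero, so it may be inserted to make all terms
    -- comparable.
    have e₁ : (-1 : k) ^ ((q.length + 1) * r.length) •
        (if r.length = 0 then zcls a₀ (q.append r) else 0)
        = if r.length = 0 then zcls a₀ (q.append r) else 0 := by
      split_ifs with hr <;> simp [hr]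
    have e₂ : (-1 : k) ^ (q.length * (r.length + 1)) •
        (if q.length = 0 then zcls a₀ (q.append r) else 0)
        = if q.length = 0 then zcls a₀ (q.append r) else 0 := by
      split_ifs with hq <;> simp [hq]
    rw [← e₁, ← e₂,
      firstTerm_congr r (g := fun _ c r' => (-1 : k) ^ ((q.length + 1) * r.length) •
        zcls c (r'.append (cons a₀ q))) (fun _ _ _ h => by rw [h]), firstTerm_smul,
      lastTerm_congr q (g := fun _ q' c => (-1 : k) ^ (q.length * (r.length + 1)) •
        zcls c (r.append (cons a₀ q'))) (fun _ _ _ h => by rw [h]), lastTerm_smul,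
      map_smul, b_zcls]
    simp only [ClosedHom.one_comp, ClosedHom.comp_one, length_append, length_cons]
    rw [h₁, h₂]
    rcases neg_one_pow_eq_or k q.length with hq | hq <;>
      rcases neg_one_pow_eq_or k r.length with hr | hr <;>
      simp only [pow_add, pow_mul, mul_add, add_mul, mul_one, one_mul, pow_one, hq, hr] <;>
      module
  rw [B_b_zcls, B_zcls, map_sumSplits, eq_neg_iff_add_eq_zero, ← sumSplits_add,
    sumSplits_congr p h, sumSplits_add, sumSplits_sub, sumSplits_sub, sumSplits_right_nil,
    sumSplits_left_nil, sub_self, zero_add, sub_eq_zero]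
  -- The unrotated word `a₀[p]` has cancelled; the other rotations are indexed by the letter `c` of
  -- `p` that becomes the head.
  exact sumSplits_firstTerm p fun t s q c r =>
    (-1 : k) ^ ((q.length + 1) * (r.length + 1)) • zcls c (r.append (cons a₀ q))

/-- Each rotation moves the head `1` into the tail, where normalization kills it. As all words of
`B` have head `1`, this also gives `B² = 0`. -/
theorem B_zcls_one {x : A.Obj} (p : ZWord A x x) : A.B (zcls (ClosedHom.one A x) p) = 0 := by
  rw [B_zcls, ← sumSplits_zero p]
  exact sumSplits_congr p fun t q r _ => by rw [zcls_one_letter, smul_zero]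

end closedWords

end DGCategory

/-! ### The contracting homotopy given by a separability element -/

namespace DGCategory

section homotopy

variable {k : Type w'} [CommRing k] {G : Type w} [AddCommGroupWithOne G] [GradingParity G]
variable {A : DGCategory.{u, v} k G}

open ZWord

variable (e : ∀ x : A.Obj, List (Σ m, A.ClosedHom m x × A.ClosedHom x m))

/-- The chain `∑ a₀ u[v|a₁|…|aₙ]`, the sum over the pairs `(u, v)` of `e x`, for `x` the domain
of `a₀`. -/
noncomputable def insertionWord {x y : A.Obj} {g : G} (a₀ : A.grade x y g) (p : BarWord A x y) :
    A.NormChain :=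
  ((e x).map fun z => A.cls (A.hcomp a₀ (ClosedHom.toGrade z.2.1))
    (.cons (ClosedHom.toGrade z.2.2) p)).sum

lemma isLin_insertionWord_head {x y : A.Obj} {g : G} (p : BarWord A x y) :
    IsLin (k := k) fun a₀ : A.grade x y g => insertionWord e a₀ p :=
  IsLin.sum _ fun _ => (isLin_cls_head _).comp' (isLin_hcomp_left _)

lemma isLin_insertionWord_tail {x y t s : A.Obj} {g h : G} (a₀ : A.grade x y g)
    (q : BarWord A x t) (r : BarWord A s y) :
    IsLin (k := k) fun a : A.grade s t h => insertionWord e a₀ (q.append (.cons a r)) :=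
  IsLin.sum _ fun z => isLin_cls_tail _ (BarWord.cons (ClosedHom.toGrade z.2.2) q) r

lemma insertionWord_unit {x y t : A.Obj} {g : G} (a₀ : A.grade x y g) (q : BarWord A x t)
    (r : BarWord A t y) : insertionWord e a₀ (q.append (.cons (A.hone t) r)) = 0 :=
  List.sum_eq_zero fun _ h => by
    obtain ⟨z, -, rfl⟩ := List.mem_map.1 h
    exact cls_unit _ (BarWord.cons (ClosedHom.toGrade z.2.2) q) r

/-- The operator `a₀[a₁|…|aₙ] ↦ ∑ a₀ u[v|a₁|…|aₙ]`, the sum over the pairs `(u, v)` of `e x`, for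
`x` the domain of `a₀`. -/
noncomputable def insertion : A.NormChain →ₗ[k] A.NormChain :=
  A.relSubmodule.liftQ
    (Finsupp.linearCombination k fun c : HWord A => insertionWord e c.head c.tail)
    (relSubmodule_le_ker (fun a p => insertionWord e a p) (isLin_insertionWord_head e)
      (isLin_insertionWord_tail e) (insertionWord_unit e))

lemma insertion_cls {x y : A.Obj} {g : G} (a₀ : A.grade x y g) (p : BarWord A x y) :
    insertion e (A.cls a₀ p) = insertionWord e a₀ p := by simp [insertion, cls]

lemma insertion_zcls {x y : A.Obj} (a₀ : A.ClosedHom x y) (p : ZWord A x y) :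
    insertion e (zcls a₀ p)
      = ((e x).map fun z => zcls (ClosedHom.comp a₀ z.2.1) (cons z.2.2 p)).sum := by
  rw [zcls, insertion_cls, insertionWord]
  congr 1
  refine List.map_congr_left fun z _ => ?_
  exact cls_congr (a' := ClosedHom.toGrade (ClosedHom.comp a₀ z.2.1)) (add_zero 0) rfl _

lemma sum_map_sub {ι V : Type*} [AddCommGroup V] (l : List ι) (f g : ι → V) :
    (l.map fun i => f i - g i).sum = (l.map f).sum - (l.map g).sum := by
  induction l with
  | nil => simp
  | cons i l ih => simp only [List.map_cons, List.sum_cons, ih]; abel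

lemma sum_map_smul {ι V : Type*} [AddCommGroup V] [Module k V] (l : List ι) (c : k) (f : ι → V) :
    (l.map fun i => c • f i).sum = c • (l.map f).sum := by
  rw [List.smul_sum, List.map_map]; rfl

lemma sum_map_mergeSum {ι V : Type*} [AddCommGroup V] [Module k V] (l : List ι) {t s : A.Obj}
    (p : ZWord A t s) (f : ι → ZWord A t s → V) :
    (l.map fun i => p.mergeSum (f i)).sum = p.mergeSum fun q => (l.map fun i => f i q).sum := by
  induction l with
  | nil => simpa using (mergeSum_smul p (0 : k) fun _ => (0 : V)).symm
  | cons i l ih => simp only [List.map_cons, List.sum_cons, mergeSum_add, ih]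

lemma sum_map_lastTerm {ι V : Type*} [AddCommGroup V] [Module k V] (l : List ι) {t s : A.Obj}
    (p : ZWord A t s) (f : ι → ∀ y, ZWord A t y → A.ClosedHom s y → V) :
    (l.map fun i => p.lastTerm (f i)).sum
      = p.lastTerm fun y q a => (l.map fun i => f i y q a).sum := by
  induction l with
  | nil => simpa using (lastTerm_smul p (0 : k) fun _ _ _ => (0 : V)).symm
  | cons i l ih => simp only [List.map_cons, List.sum_cons, lastTerm_add, ih]

/-- The morphism `a` commutes with `e` in every bilinear expression. -/
def IsCentral {x y : A.Obj} (a : A.ClosedHom x y) : Prop :=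
  ∀ f : ∀ m, A.ClosedHom m y →ₗ[k] A.ClosedHom x m →ₗ[k] A.NormChain,
    ((e x).map fun z => f z.1 (ClosedHom.comp a z.2.1) z.2.2).sum
      = ((e y).map fun z => f z.1 z.2.1 (ClosedHom.comp z.2.2 a)).sum

variable {e}

lemma isCentral_one (x : A.Obj) : IsCentral e (ClosedHom.one A x) := fun f => by simp

/-- Move `a'` across while `a` stays in the left slot, then move `a` while `a'` stays in the right
slot. -/
lemma IsCentral.comp {x y z : A.Obj} {a : A.ClosedHom y z} {a' : A.ClosedHom x y}
    (h : IsCentral e a) (h' : IsCentral e a') : IsCentral e (ClosedHom.comp a a') := fun f => by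
  have h₁ := h' fun m => (f m) ∘ₗ ClosedHom.comp a
  have h₂ := h fun m => (f m).compl₂ (ClosedHom.comp.flip a')
  simp only [LinearMap.comp_apply, LinearMap.compl₂_apply, LinearMap.flip_apply] at h₁ h₂
  simp only [ClosedHom.comp_assoc, h₁]
  simpa only [ClosedHom.comp_assoc] using h₂

lemma IsCentral.add {x y : A.Obj} {a a' : A.ClosedHom x y}
    (h : IsCentral e a) (h' : IsCentral e a') : IsCentral e (a + a') := fun f => by
  simp only [map_add, LinearMap.add_apply, List.sum_map_add, h f, h' f]

lemma IsCentral.smul {x y : A.Obj} {a : A.ClosedHom x y} (c : k)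
    (h : IsCentral e a) : IsCentral e (c • a) := fun f => by
  simp only [map_smul, LinearMap.smul_apply, sum_map_smul, h f]

/-- The first face of `a₀ u[v|c|…]` gives back the word since `∑ u v = 1`. Its second face `a₀ u[v
c|…]` cancels `a₀ c u[v|…]` from `h b` because `c` is central. All later faces commute with the
insertion up to the sign of the shift by one place. In length 0 the last face `v a₀ u` would remain.
-/
lemma b_insertion_add_insertion_b {x y : A.Obj}
    (hone : ((e x).map fun z => ClosedHom.comp z.2.1 z.2.2).sum = ClosedHom.one A x)
    (a₀ : A.ClosedHom x y) {p : ZWord A x y} (hp : p.All (IsCentral e)) (hn : p.length ≠ 0) :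
    A.b (insertion e (zcls a₀ p)) + insertion e (A.b (zcls a₀ p)) = zcls a₀ p := by
  cases p with
  | nil => simp at hn
  | cons c p =>
    have h₀ : ((e _).map fun z => zcls (ClosedHom.comp (ClosedHom.comp a₀ z.2.1) z.2.2)
        (cons c p)).sum = zcls a₀ (cons c p) := by
      have := congrArg (zclsHead (cons c p) ∘ₗ ClosedHom.comp a₀) hone
      rw [map_list_sum, List.map_map] at this
      simpa [Function.comp_def, ClosedHom.comp_assoc] using this
    have h₁ : ((e _).map fun z => zcls (ClosedHom.comp (ClosedHom.comp a₀ c) z.2.1)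
          (cons z.2.2 p)).sum
        = ((e _).map fun z => zcls (ClosedHom.comp a₀ z.2.1)
          (cons (ClosedHom.comp z.2.2 c) p)).sum := by
      have := hp.1 fun m => LinearMap.mk₂ k
        (fun u v => zcls (ClosedHom.comp a₀ u) (cons v p))
        (fun u u' v => by simp [← zclsHead_apply]) (fun c u v => by simp [← zclsHead_apply])
        (fun u v v' => by simp [← zclsCons_apply]) (fun c u v => by simp [← zclsCons_apply])
      simp only [ClosedHom.comp_assoc]
      exact this
    rw [b_zcls, map_add, map_sub, map_smul, map_firstTerm, map_mergeSum, map_lastTerm,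
      insertion_zcls, map_list_sum, List.map_map]
    simp only [insertion_zcls, Function.comp_def, b_zcls, firstTerm, mergeSum, lastTerm,
      length_cons, List.sum_map_add, sum_map_sub, sum_map_smul, sum_map_mergeSum, sum_map_lastTerm, h₀,
      h₁]
    simp only [ClosedHom.comp_assoc, pow_succ]
    module

variable (e) in
/-- The span of the words of length `n` with all letters central. -/
noncomputable def centralWords (n : ℕ) : Submodule k A.NormChain :=
  Submodule.span k {z | ∃ (x y : A.Obj) (a₀ : A.ClosedHom x y) (p : ZWord A x y),
    IsCentral e a₀ ∧ p.All (IsCentral e) ∧ p.length = n ∧ z = zcls a₀ p}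

lemma zcls_mem_centralWords {x y : A.Obj} {a₀ : A.ClosedHom x y} {p : ZWord A x y}
    (h₀ : IsCentral e a₀) (hp : p.All (IsCentral e)) : zcls a₀ p ∈ centralWords e p.length :=
  Submodule.subset_span ⟨x, y, a₀, p, h₀, hp, rfl, rfl⟩

lemma insertion_mem_centralWords
    (he : ∀ x, ∀ z ∈ e x, IsCentral e z.2.1 ∧ IsCentral e z.2.2) {n : ℕ} {c : A.NormChain}
    (hc : c ∈ centralWords e n) : insertion e c ∈ centralWords e (n + 1) := by
  induction hc using Submodule.span_induction with
  | mem c h =>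
    obtain ⟨x, y, a₀, p, h₀, hp, rfl, rfl⟩ := h
    rw [insertion_zcls]
    refine list_sum_mem fun d hd => ?_
    obtain ⟨z, hz, rfl⟩ := List.mem_map.1 hd
    exact zcls_mem_centralWords (p := cons z.2.2 p) (h₀.comp (he _ z hz).1) ⟨(he _ z hz).2, hp⟩
  | zero => simp
  | add c c' _ _ h h' => rw [map_add]; exact add_mem h h'
  | smul r c _ h => rw [map_smul]; exact Submodule.smul_mem _ _ h

lemma ZWord.sumSplits_mem {V : Type*} [AddCommGroup V] [Module k V] (S : Submodule k V)
    {C : ∀ {x y : A.Obj}, A.ClosedHom x y → Prop} {t s : A.Obj} {p : ZWord A t s}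
    (hp : p.All C) {f : ∀ y, ZWord A t y → ZWord A y s → V}
    (h : ∀ y q r, q.All C → r.All C → q.length + r.length = p.length → f y q r ∈ S) :
    p.sumSplits f ∈ S := by
  induction p with
  | nil => exact h _ _ _ trivial trivial rfl
  | cons a p ih =>
    refine add_mem (h _ _ _ trivial hp (by simp)) (ih hp.2 fun y q r hq hr hl => ?_)
    exact h _ _ _ ⟨hp.1, hq⟩ hr (by simp only [length_cons, ← hl]; omega)

/-- This is why `centralWords` asks for a central head: `B` turns it into a letter of the tail. -/
lemma B_mem_centralWords {n : ℕ} {c : A.NormChain}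
    (hc : c ∈ centralWords e n) : A.B c ∈ centralWords e (n + 1) := by
  induction hc using Submodule.span_induction with
  | mem c h =>
    obtain ⟨x, y, a₀, p, h₀, hp, rfl, rfl⟩ := h
    rw [B_zcls]
    refine ZWord.sumSplits_mem _ hp fun t q r hq hr hl => Submodule.smul_mem _ _ ?_
    have := zcls_mem_centralWords (isCentral_one t) (hr.append (q := cons a₀ q) ⟨h₀, hq⟩)
    rwa [length_append, length_cons, ← add_assoc, add_comm r.length, hl] at this
  | zero => simp
  | add c c' _ _ h h' => rw [map_add]; exact add_mem h h'
  | smul r c _ h => rw [map_smul]; exact Submodule.smul_mem _ _ h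

lemma b_B_add_B_b {n : ℕ} {c : A.NormChain} (hc : c ∈ centralWords e n) :
    A.b (A.B c) = - A.B (A.b c) := by
  induction hc using Submodule.span_induction with
  | mem c h =>
    obtain ⟨x, y, a₀, p, -, -, -, rfl⟩ := h
    exact b_B_zcls a₀ p
  | zero => simp
  | add c c' _ _ h h' => simp only [map_add, h, h', neg_add]
  | smul r c _ h => simp only [map_smul, h, smul_neg]

lemma B_B {n : ℕ} {c : A.NormChain} (hc : c ∈ centralWords e n) : A.B (A.B c) = 0 := by
  induction hc using Submodule.span_induction with
  | mem c h =>
    obtain ⟨x, y, a₀, p, -, -, -, rfl⟩ := h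
    rw [B_zcls, map_sumSplits, ← sumSplits_zero p]
    refine sumSplits_congr p fun t q r _ => ?_
    rw [map_smul, B_zcls_one, smul_zero]
  | zero => simp
  | add c c' _ _ h h' => simp only [map_add, h, h', add_zero]
  | smul r c _ h => simp only [map_smul, h, smul_zero]

lemma b_insertion_of_b_eq_zero
    (hone : ∀ x, ((e x).map fun z => ClosedHom.comp z.2.1 z.2.2).sum = ClosedHom.one A x)
    {n : ℕ} {c : A.NormChain} (hc : c ∈ centralWords e (n + 1)) (hb : A.b c = 0) :
    A.b (insertion e c) = c := by
  -- The homotopy identity is linear in `c` and can be checked on generators; being a cycle cannot.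
  suffices h : A.b (insertion e c) + insertion e (A.b c) = c by simpa [hb] using h
  clear hb
  induction hc using Submodule.span_induction with
  | mem c h =>
    obtain ⟨x, y, a₀, p, -, hp, hn, rfl⟩ := h
    exact b_insertion_add_insertion_b (hone x) a₀ hp (by omega)
  | zero => simp
  | add c c' _ _ h h' => simp only [map_add]; nth_rw 3 [← h]; nth_rw 3 [← h']; abel
  | smul r c _ h => simp only [map_smul]; rw [← smul_add, h]

lemma centralWords_le_chainDeg (n : ℕ) : centralWords e n ≤ A.chainDeg (-(n : G)) := by
  refine Submodule.span_le.2 ?_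
  rintro _ ⟨x, y, a₀, p, -, -, rfl, rfl⟩
  refine Submodule.subset_span ⟨⟨ClosedHom.toGrade a₀, p.toBar⟩, ?_, rfl⟩
  simp [HWord.deg, deg_toBar]

/-- A cycle of the negative cyclic complex on central words is a boundary as soon as its part of
`u`-degree `0` is a Hochschild boundary. -/
theorem exists_negDiff_eq
    (hone : ∀ x, ((e x).map fun z => ClosedHom.comp z.2.1 z.2.2).sum = ClosedHom.one A x)
    (he : ∀ x, ∀ z ∈ e x, IsCentral e z.2.1 ∧ IsCentral e z.2.2)
    {ζ : A.NegChain} (hζ : ∀ m, ζ m ∈ centralWords e (2 * m)) (hd : A.negDiff ζ = 0)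
    {w₀ : A.NormChain} (hw₀ : w₀ ∈ centralWords e 1) (hb : A.b w₀ = ζ 0) :
    ∃ w ∈ A.negDeg (0 - 1), A.negDiff w = ζ := by
  -- The coefficient of `u ^ (m + 1)` in `(b + u B) w = ζ` reads `b w_{m+1} = ζ_{m+1} - B w_m`, and
  -- the insertion inverts `b` on cycles of positive length.
  let w : ℕ → A.NormChain := fun m =>
    Nat.rec w₀ (fun m c => insertion e (ζ (m + 1) - A.B c)) m
  have hw : ∀ m, w m ∈ centralWords e (2 * m + 1) := by
    intro m
    induction m with
    | zero => exact hw₀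
    | succ m ih => exact insertion_mem_centralWords he (sub_mem (hζ (m + 1)) (B_mem_centralWords ih))
  have hζb : ∀ m, A.b (ζ (m + 1)) = - A.B (ζ m) := fun m => by
    have := congrFun hd (m + 1)
    exact eq_neg_of_add_eq_zero_left this
  -- The obstruction is `b (ζ_{m+1} - B w_m) = - B ζ_m + B b w_m`. Requiring it to vanish is weaker
  -- than `b w_m = ζ_m`, which fails for `m > 0` in general, and it propagates because `B² = 0`.
  have hstep : ∀ m, A.B (A.b (w m)) = A.B (ζ m) → A.b (w (m + 1)) = ζ (m + 1) - A.B (w m) := by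
    intro m hm
    refine b_insertion_of_b_eq_zero hone (n := 2 * m + 1)
      (sub_mem (hζ (m + 1)) (B_mem_centralWords (hw m))) ?_
    rw [map_sub, hζb, b_B_add_B_b (hw m), hm]
    abel
  have hBb : ∀ m, A.B (A.b (w m)) = A.B (ζ m) := by
    intro m
    induction m with
    | zero => exact congrArg A.B hb
    | succ m ih => rw [hstep m ih, map_sub, B_B (hw m), sub_zero]
  refine ⟨w, ?_, ?_⟩
  · refine (Submodule.mem_pi).2 fun m _ => ?_
    have := centralWords_le_chainDeg _ (hw m)
    convert this using 2
    push_cast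
    abel
  · funext m
    cases m with
    | zero => exact (add_zero _).trans hb
    | succ m =>
      change A.b (w (m + 1)) + A.B (w m) = ζ (m + 1)
      rw [hstep m (hBb m), sub_add_cancel]

end homotopy

end DGCategory

/-! ### The cycle `η_π` of an idempotent -/

namespace DGCategory

section eta

variable {k : Type w'} [CommRing k] {G : Type w} [AddCommGroupWithOne G] [GradingParity G]
variable {A : DGCategory.{u, v} k G}

open ZWord

namespace ZWord

/-- The word `[a|…|a]` with `n` letters. -/
def rep {x : A.Obj} (a : A.ClosedHom x x) : ℕ → ZWord A x x
  | 0 => nil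
  | n + 1 => cons a (rep a n)

variable {N : A.Obj} (π : A.ClosedHom N N)

@[simp] lemma length_rep (n : ℕ) : (rep π n).length = n := by
  induction n with
  | zero => rfl
  | succ n ih => rw [rep, length_cons, ih]

lemma rep_append (m n : ℕ) : (rep π m).append (rep π n) = rep π (m + n) := by
  induction m with
  | zero => rw [zero_add]; rfl
  | succ m ih => rw [Nat.add_right_comm, rep, rep, cons_append, ih]

lemma toBar_rep (n : ℕ) : (rep π n).toBar = BarWord.rep (ClosedHom.toGrade π) n := by
  induction n with
  | zero => rfl
  | succ n ih => rw [rep, toBar, BarWord.rep, ih]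

lemma All.rep {C : ∀ {x y : A.Obj}, A.ClosedHom x y → Prop} (h : C π) (n : ℕ) :
    (rep π n).All C := by
  induction n with
  | zero => trivial
  | succ n ih => exact ⟨h, ih⟩

variable {V : Type*} [AddCommGroup V]

lemma lastTerm_rep (n : ℕ) (f : ∀ y, ZWord A N y → A.ClosedHom N y → V) :
    (rep π (n + 1)).lastTerm f = f N (rep π n) π := by
  induction n generalizing f with
  | zero => rfl
  | succ n ih => exact ih fun y q c => f y (cons π q) c

lemma sumSplits_rep (n : ℕ) (f : ∀ y, ZWord A N y → ZWord A y N → V) (c : V)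
    (h : ∀ i j, i + j = n → f N (rep π i) (rep π j) = c) :
    (rep π n).sumSplits f = (n + 1) • c := by
  induction n generalizing f with
  | zero => simpa [rep, sumSplits] using h 0 0 rfl
  | succ n ih =>
    rw [rep, sumSplits, ih (fun y q r => f y (cons π q) r) fun i j hij =>
      h (i + 1) j (by omega)]
    have := h 0 (n + 1) (by omega)
    rw [rep, rep] at this
    rw [this, add_smul (n + 1) 1, one_smul, add_comm]

/-- All `n` merges give the same word because `π` is idempotent, and the signs alternate starting
with `+`. -/
lemma mergeSum_rep {π : A.ClosedHom N N} (hπ : ClosedHom.comp π π = π) (n : ℕ) (f : ZWord A N N → V) :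
    (rep π (n + 1)).mergeSum f = if Even n then 0 else f (rep π n) := by
  induction n generalizing f with
  | zero => rfl
  | succ n ih =>
    have : (rep π (n + 1 + 1)).mergeSum f = f (rep π (n + 1)) -
        (rep π (n + 1)).mergeSum fun q => f (cons π q) := by
      simp only [rep, mergeSum, hπ]
    rw [this, ih]
    by_cases h : Even n <;> simp [rep, h, Nat.even_add_one]

end ZWord

variable {N : A.Obj} {π : A.ClosedHom N N}

/-- Both outer faces have head `π (2π - 1) = (2π - 1) π = π`, and the inner faces leave one copy
with head `2π - 1`. In total the head is `π + π - (2π - 1) = 1`. -/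
lemma b_zcls_rep (hπ : ClosedHom.comp π π = π) (m : ℕ) :
    A.b (zcls ((2 : k) • π - ClosedHom.one A N) (rep π (2 * (m + 1))))
      = zcls (ClosedHom.one A N) (rep π (2 * m + 1)) := by
  rw [show 2 * (m + 1) = 2 * m + 1 + 1 by ring, b_zcls, mergeSum_rep hπ, lastTerm_rep,
    if_neg (by simp), length_rep, rep, firstTerm]
  simp only [map_sub, map_smul, LinearMap.sub_apply, LinearMap.smul_apply, hπ,
    ClosedHom.one_comp, ClosedHom.comp_one]
  simp only [← zclsHead_apply, map_sub, map_smul]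
  simp only [pow_succ, pow_mul]
  module

/-- All `2 m + 1` rotations give the same word. As `i + j` is even, `i + 1` and `j` have opposite
parity, so every sign is `+`. -/
lemma B_zcls_rep (m : ℕ) :
    A.B (zcls π (rep π (2 * m)))
      = (2 * m + 1) • zcls (ClosedHom.one A N) (rep π (2 * m + 1)) := by
  rw [B_zcls]
  refine sumSplits_rep π _ _ _ fun i j hij => ?_
  have : Even ((i + 1) * j) := by
    rcases Nat.even_or_odd j with hj | hj
    · exact hj.mul_left _
    · refine Even.mul_right ?_ _
      have : Odd i := by
        rcases Nat.even_or_odd i with hi | hi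
        · exfalso
          have := hi.add_odd hj
          rw [hij] at this
          exact (Nat.not_odd_iff_even.2 (even_two_mul m)) this
        · exact hi
      exact this.add_one
  rw [length_rep, length_rep, this.neg_one_pow, one_smul,
    show cons π (rep π i) = rep π (i + 1) from rfl, rep_append]
  congr 2
  omega

lemma B_zcls_two_smul_sub_one_rep (m : ℕ) :
    A.B (zcls ((2 : k) • π - ClosedHom.one A N) (rep π (2 * m)))
      = (2 * (2 * m + 1) : k) • zcls (ClosedHom.one A N) (rep π (2 * m + 1)) := by
  rw [← zclsHead_apply, map_sub, map_smul, map_sub, map_smul, zclsHead_apply, zclsHead_apply,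
    B_zcls_rep, B_zcls_one, sub_zero, ← Nat.cast_smul_eq_nsmul k, smul_smul]
  push_cast
  rfl

/-- The factor `2 (2 (m + 1) + 1)` is the one in `B_zcls_two_smul_sub_one_rep`; with the alternating
sign this cancels consecutive terms of `η_π`. -/
lemma factorial_div_succ (m : ℕ) :
    (2 * (m + 2)).factorial / (2 * (m + 2).factorial)
      = 2 * (2 * (m + 1) + 1) * ((2 * (m + 1)).factorial / (2 * (m + 1).factorial)) := by
  refine Nat.div_eq_of_eq_mul_left (by positivity) ?_
  have h := Nat.div_mul_cancel (two_mul_factorial_dvd m)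
  rw [show 2 * (m + 2) = 2 * (m + 1) + 1 + 1 by ring, Nat.factorial_succ, Nat.factorial_succ,
    Nat.factorial_succ (m + 1)]
  nth_rw 1 [← h]
  ring

lemma eta_zero : A.eta N (ClosedHom.toGrade π) 0 = zcls π nil := rfl

lemma eta_succ (m : ℕ) : A.eta N (ClosedHom.toGrade π) (m + 1)
    = ((-1) ^ (m + 1) * (((2 * (m + 1)).factorial / (2 * (m + 1).factorial) : ℕ) : k)) •
      zcls ((2 : k) • π - ClosedHom.one A N) (rep π (2 * (m + 1))) := by
  rw [eta, zcls, toBar_rep]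
  rfl

lemma b_zcls_nil {x : A.Obj} (a : A.ClosedHom x x) : A.b (zcls a nil) = 0 := by
  rw [b_zcls]
  simp [firstTerm, mergeSum, lastTerm]

theorem negDiff_eta (hπ : ClosedHom.comp π π = π) :
    A.negDiff (A.eta N (ClosedHom.toGrade π)) = 0 := by
  funext m
  rcases m with _ | _ | m
  · change A.b (zcls π nil) + 0 = 0
    rw [b_zcls_nil, add_zero]
  -- The coefficient of `u` is separate because the term `π` of `η_π` does not follow the pattern
  -- `2π - 1`. Here `2! / (2 · 1!) = 1` matches `B π = 1[π]`.
  · change A.b (A.eta N _ 1) + A.B (A.eta N _ 0) = 0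
    have h := B_zcls_rep (π := π) 0
    rw [eta_succ, eta_zero, map_smul, b_zcls_rep hπ]
    rw [rep, mul_zero] at h
    rw [h]
    simp [Nat.factorial]
  · change A.b (A.eta N _ (m + 2)) + A.B (A.eta N _ (m + 1)) = 0
    rw [eta_succ (m + 1), eta_succ m, map_smul, map_smul, b_zcls_rep hπ, B_zcls_two_smul_sub_one_rep,
      factorial_div_succ, smul_smul, ← add_smul]
    convert zero_smul k _
    push_cast
    ring

end eta


end DGCategory

/-! ### Functoriality of the negative cyclic complex in dg functors -/

namespace DGCategory

universe u₁ v₁ u₂ v₂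

/-- A dg functor. -/
structure DGFunctor {k : Type w'} [CommRing k] {G : Type w} [AddCommGroupWithOne G]
    [GradingParity G] (A : DGCategory.{u₁, v₁} k G) (A' : DGCategory.{u₂, v₂} k G) where
  obj : A.Obj → A'.Obj
  map : ∀ {x y}, A.Hom x y →ₗ[k] A'.Hom (obj x) (obj y)
  map_mem : ∀ {x y g} {f : A.Hom x y}, f ∈ A.grade x y g → map f ∈ A'.grade (obj x) (obj y) g
  map_d : ∀ {x y} (f : A.Hom x y), map (A.d x y f) = A'.d _ _ (map f)
  map_comp : ∀ {x y z} (f : A.Hom y z) (f' : A.Hom x y),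
    map (A.comp f f') = A'.comp (map f) (map f')
  map_one : ∀ x, map (A.one x) = A'.one (obj x)

namespace DGFunctor

variable {k : Type w'} [CommRing k] {G : Type w} [AddCommGroupWithOne G] [GradingParity G]
variable {A : DGCategory.{u₁, v₁} k G} {A' : DGCategory.{u₂, v₂} k G} (F : DGFunctor A A')

/-- The image of a homogeneous morphism. -/
def hmap {x y : A.Obj} {g : G} (a : A.grade x y g) : A'.grade (F.obj x) (F.obj y) g :=
  ⟨F.map (a : A.Hom x y), F.map_mem a.2⟩

lemma hmap_hd {x y : A.Obj} {g : G} (a : A.grade x y g) : F.hmap (A.hd a) = A'.hd (F.hmap a) :=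
  Subtype.ext (F.map_d _)

lemma hmap_hcomp {x y z : A.Obj} {g h : G} (a : A.grade y z g) (a' : A.grade x y h) :
    F.hmap (A.hcomp a a') = A'.hcomp (F.hmap a) (F.hmap a') :=
  Subtype.ext (F.map_comp _ _)

lemma hmap_hone (x : A.Obj) : F.hmap (A.hone x) = A'.hone (F.obj x) :=
  Subtype.ext (F.map_one x)

lemma isLin_hmap {x y : A.Obj} {g : G} : IsLin (k := k) fun a : A.grade x y g => F.hmap a := by
  intro c a a'; ext; simp [hmap]

/-- The image of a word. -/
def mapWord : ∀ {t s : A.Obj}, BarWord A t s → BarWord A' (F.obj t) (F.obj s)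
  | _, _, .nil => .nil
  | _, _, .cons a p => .cons (F.hmap a) (mapWord p)

lemma mapWord_append {t y s : A.Obj} (p : BarWord A t y) (q : BarWord A y s) :
    F.mapWord (p.append q) = (F.mapWord p).append (F.mapWord q) := by
  induction p with
  | nil => rfl
  | cons a p ih => simp only [BarWord.cons_append, mapWord, ih]

lemma deg_mapWord {t s : A.Obj} (p : BarWord A t s) : (F.mapWord p).deg = p.deg := by
  induction p with
  | nil => rfl
  | cons a p ih => simp only [mapWord, BarWord.deg, ih]

lemma mapWord_rep {x : A.Obj} {g : G} (a : A.grade x x g) (n : ℕ) :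
    F.mapWord (BarWord.rep a n) = BarWord.rep (F.hmap a) n := by
  induction n with
  | zero => rfl
  | succ n ih => rw [BarWord.rep, mapWord, ih, BarWord.rep]

lemma sum_splits_mapWord {V : Type*} [AddCommGroup V] {t s : A.Obj} (p : BarWord A t s)
    (f : ∀ y, BarWord A' (F.obj t) y → BarWord A' y (F.obj s) → V) :
    ((F.mapWord p).splits.map fun z => f z.1 z.2.1 z.2.2).sum
      = (p.splits.map fun z => f _ (F.mapWord z.2.1) (F.mapWord z.2.2)).sum := by
  induction p with
  | nil => simp [mapWord, BarWord.splits]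
  | cons a p ih =>
    simp only [mapWord, BarWord.splits, List.map_cons, List.map_map, List.sum_cons,
      Function.comp_def]
    rw [ih fun y q r => f y (.cons (F.hmap a) q) r]

/-- The map of normalized Hochschild chains induced by a dg functor. -/
noncomputable def chainMap : A.NormChain →ₗ[k] A'.NormChain :=
  A.relSubmodule.liftQ (Finsupp.linearCombination k fun c : HWord A =>
      A'.cls (F.hmap c.head) (F.mapWord c.tail))
    (relSubmodule_le_ker (fun a p => A'.cls (F.hmap a) (F.mapWord p))
      (fun p => (isLin_cls_head (F.mapWord p)).comp' F.isLin_hmap)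
      (fun a₀ q r => by
        simpa only [mapWord_append, mapWord] using
          (isLin_cls_tail (F.hmap a₀) (F.mapWord q) (F.mapWord r)).comp' F.isLin_hmap)
      (fun a₀ q r => by
        simpa only [mapWord_append, mapWord, hmap_hone] using
          cls_unit (F.hmap a₀) (F.mapWord q) (F.mapWord r)))

lemma chainMap_cls {x y : A.Obj} {g : G} (a₀ : A.grade x y g) (p : BarWord A x y) :
    F.chainMap (A.cls a₀ p) = A'.cls (F.hmap a₀) (F.mapWord p) := by simp [chainMap, cls]

lemma chainMap_bPart {x y t : A.Obj} {g : G} (a₀ : A.grade x y g) (q : BarWord A x t)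
    (r : BarWord A t y) :
    F.chainMap (A.bPart a₀ q r) = A'.bPart (F.hmap a₀) (F.mapWord q) (F.mapWord r) := by
  rcases r with _ | ⟨a, _ | ⟨a', r⟩⟩
  · simp only [bPart, mapWord, map_zero]
  · simp only [bPart, mapWord, map_sub, map_smul, chainMap_cls, mapWord_append, hmap_hd,
      hmap_hcomp, deg_mapWord]
  · simp only [bPart, mapWord, map_add, map_smul, chainMap_cls, mapWord_append, hmap_hd,
      hmap_hcomp, deg_mapWord]

lemma chainMap_bHead {x y : A.Obj} {g : G} (a₀ : A.grade x y g) (p : BarWord A x y) :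
    F.chainMap (A.bHead a₀ p) = A'.bHead (F.hmap a₀) (F.mapWord p) := by
  cases p <;> simp only [bHead, mapWord, map_add, map_smul, chainMap_cls, hmap_hd, hmap_hcomp]

lemma chainMap_BPart {x y t : A.Obj} {g : G} (a₀ : A.grade x y g) (q : BarWord A x t)
    (r : BarWord A t y) :
    F.chainMap (A.BPart a₀ q r) = A'.BPart (F.hmap a₀) (F.mapWord q) (F.mapWord r) := by
  simp only [BPart, map_smul, chainMap_cls, mapWord_append, mapWord, hmap_hone, deg_mapWord]

lemma hom_ext {V : Type*} [AddCommGroup V] [Module k V] {f f' : A.NormChain →ₗ[k] V}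
    (h : ∀ {x y : A.Obj} {g : G} (a₀ : A.grade x y g) (p : BarWord A x y),
      f (A.cls a₀ p) = f' (A.cls a₀ p)) : f = f' := by
  refine Submodule.linearMap_qext _ (Finsupp.lhom_ext' fun c => LinearMap.ext_ring ?_)
  exact h c.head c.tail

lemma chainMap_b (c : A.NormChain) : F.chainMap (A.b c) = A'.b (F.chainMap c) := by
  refine LinearMap.congr_fun (f := F.chainMap ∘ₗ A.b) (g := A'.b ∘ₗ F.chainMap) (hom_ext ?_) c
  intro x y g a₀ p
  simp only [LinearMap.comp_apply, b_cls, chainMap_cls, bWord, map_add, chainMap_bHead,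
    map_list_sum, List.map_map, Function.comp_def, chainMap_bPart]
  rw [F.sum_splits_mapWord p fun _ q r => A'.bPart (F.hmap a₀) q r]

lemma chainMap_B (c : A.NormChain) : F.chainMap (A.B c) = A'.B (F.chainMap c) := by
  refine LinearMap.congr_fun (f := F.chainMap ∘ₗ A.B) (g := A'.B ∘ₗ F.chainMap) (hom_ext ?_) c
  intro x y g a₀ p
  simp only [LinearMap.comp_apply, B_cls, chainMap_cls, BWord,
    map_list_sum, List.map_map, Function.comp_def, chainMap_BPart]
  rw [F.sum_splits_mapWord p fun _ q r => A'.BPart (F.hmap a₀) q r]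

lemma chainMap_mem_chainDeg {g : G} {c : A.NormChain} (hc : c ∈ A.chainDeg g) :
    F.chainMap c ∈ A'.chainDeg g := by
  have : A.chainDeg g ≤ (A'.chainDeg g).comap F.chainMap := by
    refine Submodule.span_le.2 ?_
    rintro _ ⟨c, hc, rfl⟩
    refine Submodule.subset_span ⟨⟨F.hmap c.head, F.mapWord c.tail⟩, ?_, F.chainMap_cls _ _⟩
    simpa [HWord.deg, deg_mapWord] using hc
  exact this hc

/-- The map of negative cyclic complexes induced by a dg functor. -/
noncomputable def negMap : A.NegChain →ₗ[k] A'.NegChain := F.chainMap.compLeft ℕ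

lemma negMap_mem_negDeg {g : G} {z : A.NegChain} (hz : z ∈ A.negDeg g) :
    F.negMap z ∈ A'.negDeg g :=
  Submodule.mem_pi.2 fun i _ => F.chainMap_mem_chainDeg (Submodule.mem_pi.1 hz i trivial)

lemma negMap_negDiff (z : A.NegChain) : F.negMap (A.negDiff z) = A'.negDiff (F.negMap z) := by
  funext m
  cases m with
  | zero =>
    change F.chainMap (A.b (z 0) + 0) = A'.b (F.chainMap (z 0)) + 0
    rw [map_add, chainMap_b, map_zero]
  | succ m =>
    change F.chainMap (A.b (z (m + 1)) + A.B (z m))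
      = A'.b (F.chainMap (z (m + 1))) + A'.B (F.chainMap (z m))
    rw [map_add, chainMap_b, chainMap_B]

lemma isNegCycle_negMap {g : G} {z : A.NegChain} (hz : A.IsNegCycle g z) :
    A'.IsNegCycle g (F.negMap z) :=
  ⟨F.negMap_mem_negDeg hz.1, by rw [← negMap_negDiff, hz.2, map_zero]⟩

lemma negHomologous_negMap {g : G} {z z' : A.NegChain} (h : A.NegHomologous g z z') :
    A'.NegHomologous g (F.negMap z) (F.negMap z') := by
  obtain ⟨w, hw, h⟩ := h
  exact ⟨F.negMap w, F.negMap_mem_negDeg hw, by rw [← negMap_negDiff, h, map_sub]⟩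

lemma negMap_oneCycle (x : A.Obj) : F.negMap (A.oneCycle x) = A'.oneCycle (F.obj x) := by
  funext m
  cases m with
  | zero =>
    change F.chainMap (A.cls (A.hone x) .nil) = A'.cls (A'.hone _) .nil
    rw [chainMap_cls, hmap_hone, mapWord]
  | succ m => exact map_zero F.chainMap

lemma negMap_eta (N : A.Obj) (π : A.grade N N (0 : G)) :
    F.negMap (A.eta N π) = A'.eta (F.obj N) (F.hmap π) := by
  funext m
  cases m with
  | zero => exact F.chainMap_cls _ _
  | succ m =>
    change F.chainMap (A.eta N π (m + 1)) = _
    rw [eta, eta, map_smul, chainMap_cls, mapWord_rep]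
    congr 2
    ext
    simp [hmap, hone, map_one]

end DGFunctor

/-! ### The two-object category of a direct summand -/

section retract

variable {k : Type w'} [CommRing k] {G : Type w} [AddCommGroupWithOne G] [GradingParity G]

/-- The dg category with objects `I` and the morphisms of `A` along a map `f : I → A.Obj`. -/
def pullback (A : DGCategory.{u, v} k G) {I : Type u₁} (f : I → A.Obj) :
    DGCategory.{u₁, v} k G where
  Obj := I
  Hom x y := A.Hom (f x) (f y)
  grade x y := A.grade (f x) (f y)
  grade_isInternal x y := A.grade_isInternal (f x) (f y)
  d x y := A.d (f x) (f y)
  comp := A.comp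
  one x := A.one (f x)
  comp_assoc := A.comp_assoc
  one_comp := A.one_comp
  comp_one := A.comp_one
  one_mem x := A.one_mem (f x)
  comp_mem := A.comp_mem
  d_mem := A.d_mem
  d_d := A.d_d
  d_comp := A.d_comp

/-- The functor from a pullback to a full subcategory that contains the image. -/
def pullbackToFull (A : DGCategory.{u, v} k G) {I : Type u₁} (f : I → A.Obj) {S : Set A.Obj}
    (hf : ∀ x, f x ∈ S) : DGFunctor (A.pullback f) (A.full S) where
  obj x := (⟨f x, hf x⟩ : S)
  map {x y} := (LinearMap.id : A.Hom (f x) (f y) →ₗ[k] A.Hom (f x) (f y))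
  map_mem h := h
  map_d _ := rfl
  map_comp _ _ := rfl
  map_one _ := rfl

open ZWord

variable {A : DGCategory.{u, v} k G} {P N : A.Obj} {i : A.ClosedHom P N} {j : A.ClosedHom N P}
  {e : ∀ x : A.Obj, List (Σ m, A.ClosedHom m x × A.ClosedHom x m)}

lemma IsCentral.sub {x y : A.Obj} {a a' : A.ClosedHom x y}
    (h : IsCentral e a) (h' : IsCentral e a') : IsCentral e (a - a') := by
  simpa [sub_eq_add_neg] using h.add (h'.smul (-1))

/-- Both sides are `f i 1`: at `N` the pair `(i, j)` contributes `i ⊗ j i = i ⊗ 1`, and the other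
pair contributes nothing since `(1 - i j) i = 0`. Dually for `j`, with `j (1 - i j) = 0`. -/
lemma isCentral_inclusion (hji : ClosedHom.comp j i = ClosedHom.one A P)
    (hP : e P = [⟨P, ClosedHom.one A P, ClosedHom.one A P⟩])
    (hN : e N = [⟨P, i, j⟩, ⟨N, ClosedHom.one A N - ClosedHom.comp i j,
      ClosedHom.one A N - ClosedHom.comp i j⟩]) : IsCentral e i := fun f => by
  simp [hP, hN, hji, ClosedHom.comp_assoc]

lemma isCentral_projection (hji : ClosedHom.comp j i = ClosedHom.one A P)
    (hP : e P = [⟨P, ClosedHom.one A P, ClosedHom.one A P⟩])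
    (hN : e N = [⟨P, i, j⟩, ⟨N, ClosedHom.one A N - ClosedHom.comp i j,
      ClosedHom.one A N - ClosedHom.comp i j⟩]) : IsCentral e j := fun f => by
  simp [hP, hN, hji, ← ClosedHom.comp_assoc]

lemma oneCycle_zero (x : A.Obj) : A.oneCycle x 0 = zcls (ClosedHom.one A x) nil :=
  Pi.single_eq_same (M := fun _ : ℕ => A.NormChain) 0 (A.cls (A.hone x) .nil)

lemma oneCycle_succ (x : A.Obj) (m : ℕ) : A.oneCycle x (m + 1) = 0 :=
  Pi.single_eq_of_ne (M := fun _ : ℕ => A.NormChain) m.succ_ne_zero (A.cls (A.hone x) .nil)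

lemma zcls_nil_mem_centralWords {x : A.Obj} {a : A.ClosedHom x x} (h : IsCentral e a) :
    zcls a nil ∈ centralWords e 0 :=
  Submodule.subset_span ⟨x, x, a, nil, h, trivial, length_nil, rfl⟩

lemma negDiff_oneCycle (x : A.Obj) : A.negDiff (A.oneCycle x) = 0 := by
  funext m
  rcases m with _ | _ | m
  · change A.b (A.oneCycle x 0) + 0 = 0
    rw [oneCycle_zero, b_zcls_nil, add_zero]
  · change A.b (A.oneCycle x 1) + A.B (A.oneCycle x 0) = 0
    rw [oneCycle_zero, oneCycle_succ, B_zcls_one, map_zero, add_zero]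
  · change A.b (A.oneCycle x (m + 2)) + A.B (A.oneCycle x (m + 1)) = 0
    rw [oneCycle_succ, oneCycle_succ, map_zero, map_zero, add_zero]

/-- The comparison of `1_P` and `η_π` in a dg category with the two objects `P` and `N` only, where
`e` is `1 ⊗ 1` at `P` and `i ⊗ j + (1 - i j) ⊗ (1 - i j)` at `N`. -/
theorem negHomologous_oneCycle_eta (hji : ClosedHom.comp j i = ClosedHom.one A P)
    (hP : e P = [⟨P, ClosedHom.one A P, ClosedHom.one A P⟩])
    (hN : e N = [⟨P, i, j⟩, ⟨N, ClosedHom.one A N - ClosedHom.comp i j,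
      ClosedHom.one A N - ClosedHom.comp i j⟩])
    (hobj : ∀ x, x = P ∨ x = N) :
    A.IsNegCycle 0 (A.oneCycle P) ∧
    A.IsNegCycle 0 (A.eta N (ClosedHom.toGrade (ClosedHom.comp i j))) ∧
    A.NegHomologous 0 (A.oneCycle P) (A.eta N (ClosedHom.toGrade (ClosedHom.comp i j))) := by
  have hi := isCentral_inclusion hji hP hN
  have hj := isCentral_projection hji hP hN
  have hπ := hi.comp hj
  have hππ : ClosedHom.comp (ClosedHom.comp i j) (ClosedHom.comp i j) = ClosedHom.comp i j := by
    rw [ClosedHom.comp_assoc, ← ClosedHom.comp_assoc j, hji, ClosedHom.one_comp]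
  have hdeg : ∀ z : A.NegChain, (∀ m, z m ∈ centralWords e (2 * m)) → z ∈ A.negDeg 0 :=
    fun z hz => Submodule.mem_pi.2 fun m _ => by
      rw [zero_sub]; exact centralWords_le_chainDeg _ (hz m)
  have h₁ : ∀ m, A.oneCycle P m ∈ centralWords e (2 * m) := fun m => by
    cases m with
    | zero =>
      rw [oneCycle_zero, mul_zero]
      exact zcls_nil_mem_centralWords (isCentral_one P)
    | succ m => rw [oneCycle_succ]; exact zero_mem _
  have h₂ : ∀ m, A.eta N (ClosedHom.toGrade (ClosedHom.comp i j)) m ∈ centralWords e (2 * m) :=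
    fun m => by
    cases m with
    | zero =>
      rw [eta_zero, mul_zero]
      exact zcls_nil_mem_centralWords hπ
    | succ m =>
      rw [eta_succ]
      have := zcls_mem_centralWords ((hπ.smul 2).sub (isCentral_one N))
        (All.rep (C := IsCentral e) _ hπ (2 * (m + 1)))
      rw [length_rep] at this
      exact Submodule.smul_mem _ _ this
  have hd₁ := negDiff_oneCycle P
  have hd₂ := negDiff_eta hππ
  refine ⟨⟨hdeg _ h₁, hd₁⟩, ⟨hdeg _ h₂, hd₂⟩, ?_⟩
  -- The trace property in its simplest form: `b (j[i]) = j i - i j = 1_P - π`.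
  refine exists_negDiff_eq (e := e) (w₀ := zcls j (cons i nil)) ?_ ?_
    (fun m => sub_mem (h₁ m) (h₂ m)) (by rw [map_sub, hd₁, hd₂, sub_zero])
    (Submodule.subset_span ⟨N, P, j, cons i nil, hj, ⟨hi, trivial⟩, rfl, rfl⟩) ?_
  · intro x
    rcases hobj x with rfl | rfl
    · simp [hP]
    -- The sum is `i j + (1 - i j)² = 1`, as `1 - i j` is idempotent.
    · simp [hN, hππ]
  · intro x z hz
    rcases hobj x with rfl | rfl
    · rw [hP, List.mem_singleton] at hz
      subst hz
      exact ⟨isCentral_one _, isCentral_one _⟩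
    · rw [hN, List.mem_cons, List.mem_singleton] at hz
      rcases hz with rfl | rfl
      · exact ⟨hi, hj⟩
      · exact ⟨(isCentral_one _).sub hπ, (isCentral_one _).sub hπ⟩
  · rw [b_zcls]
    simp only [firstTerm, mergeSum, lastTerm, hji, length_cons, length_nil]
    rw [Pi.sub_apply, oneCycle_zero, eta_zero]
    module

end retract

end DGCategory

theorem mainTheorem4 {k : Type w'} [Field k] {G : Type w} [AddCommGroupWithOne G]
    [GradingParity G] (A : DGCategory.{u, v} k G) (P N : A.Obj)
    (i : A.Hom P N) (j : A.Hom N P)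
    (hi : i ∈ A.grade P N 0) (hj : j ∈ A.grade N P 0)
    (hdi : A.d P N i = 0) (hdj : A.d N P j = 0)
    (hji : A.comp j i = A.one P) :
    letI C := A.full {P, N}
    letI P' : C.Obj := ⟨P, Or.inl rfl⟩
    letI N' : C.Obj := ⟨N, Or.inr rfl⟩
    letI π : C.grade N' N' 0 := ⟨A.comp i j, A.comp_mem_zero hi hj⟩
    C.IsNegCycle 0 (C.oneCycle P') ∧
    C.IsNegCycle 0 (C.eta N' π) ∧
    C.NegHomologous 0 (C.oneCycle P') (C.eta N' π) := by
  -- The objects `P` and `N` of `A` may coincide, and then `e` could not be prescribed separately at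
  -- each. In `D` they are the distinct objects `true` and `false`, and the result is carried to the
  -- full subcategory by the functor `F`, the identity on morphisms.
  let D := A.pullback fun x : Bool => cond x P N
  let F : DGCategory.DGFunctor D (A.full {P, N}) := A.pullbackToFull _ (by rintro (_ | _) <;> simp)
  let i' : D.ClosedHom true false := ⟨i, hi, hdi⟩
  let j' : D.ClosedHom false true := ⟨j, hj, hdj⟩
  let e : ∀ x : Bool, List (Σ m : Bool, D.ClosedHom m x × D.ClosedHom x m)
    | true => [⟨true, DGCategory.ClosedHom.one D true, DGCategory.ClosedHom.one D true⟩]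
    | false => [⟨true, i', j'⟩,
        ⟨false, DGCategory.ClosedHom.one D false - DGCategory.ClosedHom.comp i' j',
          DGCategory.ClosedHom.one D false - DGCategory.ClosedHom.comp i' j'⟩]
  obtain ⟨h₁, h₂, h₃⟩ := DGCategory.negHomologous_oneCycle_eta (A := D) (P := true) (N := false)
    (i := i') (j := j') (e := e) (Subtype.ext hji) rfl rfl
    (fun x => by cases x <;> [exact Or.inr rfl; exact Or.inl rfl])
  have h := F.isNegCycle_negMap h₁
  have h' := F.isNegCycle_negMap h₂
  have h'' := F.negHomologous_negMap h₃
  have e₁ := F.negMap_oneCycle true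
  have e₂ := F.negMap_eta false (DGCategory.ClosedHom.toGrade (DGCategory.ClosedHom.comp i' j'))
  exact ⟨e₁ ▸ h, e₂ ▸ h', e₁ ▸ e₂ ▸ h''⟩
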